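/- **Setting.** Let $\mathcal H$ be a class of functions $X\to\{0,1\}$ of finite VC dimension $d$ (measurable, and such that a concept consistent with a realizable sample can be selected measurably). There are $k\ge 1$ players and a center. Player $i$ can sample from an unknown distribution $D_i$ on $X$, its samples being labelled by an unknown target $f\in\mathcal H$; the center has no data. In each round the center broadcasts a message, and then the players broadcast examples from their own samples and further bits; all parties may use private randomness, and no information is conveyed by the length or the absence of a message. At the end a hypothesis is read off the public transcript. For a confidence parameter $\delta\in(0,1)$, the class $\mathcal H$ *is learned to error $\epsilon$* by such a protocol if, for all $D_1,\dots,D_k$ and all $f\in\mathcal H$, with probability at least $1-\delta$ the hypothesis $h$ satisfies $\Pr_{x\sim D}[h(x)\ne f(x)]\le\epsilon$, where $D=\frac1k\sum_i D_i$. Communication per round is counted over all parties together. A *weight-based boosting algorithm with $r$ calls* processes a finite sample labelled by some $f\in\mathcal H$. Before its $t$-th call to the oracle it gives each example a nonnegative weight depending only on which of the hypotheses $h_1,\dots,h_{t-1}$ are correct on that example. A $\beta$-weak learning oracle answers with some $h_t:X\to\{0,1\}$ of error at most $\beta$ under the distribution proportional to the weights (any answer is allowed if all weights vanish). The final prediction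 at $x$ is a fixed function of $h_1(x),\dots,h_r(x)$. The algorithm *achieves error $\epsilon$* if for every finite sample and all such answers the final hypothesis misclassifies at most an $\epsilon$ fraction of the sample. **Theorem.** For every $\delta\in(0,1)$ there is a constant $C$, depending only on $\delta$, such that for all $X$, $\mathcal H$, $d$, $k$ as above: 1. If $0<\beta<1/2$, $\epsilon>0$, and some weight-based boosting algorithm achieves error $\epsilon$ for $\mathcal H$ by making $r$ calls to a $\beta$-weak learning oracle, then $\mathcal H$ can be learned to error $\epsilon$ by a distributed protocol in at most $C\,r$ rounds, each using at most $C\,\frac d\beta\log\frac1\beta$ examples and at most $C\,k\log\frac d\beta$ bits of communication. 2. For $0<\epsilon\le 1/2$, $\mathcal H$ can be learned to error $\epsilon$ in at most $C\log\frac1\epsilon$ rounds, each using at most $C\,d$ examples and at most $C\,k\log(d+1)$ bits of communication. 3. For $0<\epsilon\le 1/2$ and every real $c\ge 1$, $\mathcal H$ can be learned to error $\epsilon$ in at most $C\,c$ rounds, each using at most $C\,\frac{d}{\epsilon^{1/c}}\log\frac1\epsilon$ examples and at most $C\,k\log\frac d\epsilon$ bits of communication. (If $d=0$, the bounds on examples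 and bits are to be read as $0$.) -/

import Mathlib

open MeasureTheory
open scoped ENNReal

universe u

namespace DistLearn

/-! ## Concept classes -/

/-- `H` shatters the finite set `S`: every labelling of `S` is realized by a member of `H`. -/
def Shatters {X : Type u} (H : Set (X → Bool)) (S : Finset X) : Prop :=
  ∀ b : X → Bool, ∃ h ∈ H, ∀ x ∈ S, h x = b x

/-- `H` has (finite) VC dimension `d`: the largest size of a shattered set is `d`. -/
def HasVCDim {X : Type u} (H : Set (X → Bool)) (d : ℕ) : Prop :=
  IsGreatest {n : ℕ | ∃ S : Finset X, S.card = n ∧ Shatters H S} d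

/-- The usual measurability convention of learning theory: concepts are measurable, and for every
sample size a concept of `H` consistent with a (realizable) sample can be selected measurably.
Existence of a consistent concept is trivial; only measurability of the selection is required. -/
structure IsMeasurableClass {X : Type u} [MeasurableSpace X] (H : Set (X → Bool)) : Prop where
  measurable_mem : ∀ h ∈ H, Measurable h
  measurable_consistent : ∀ n : ℕ, ∃ A : (Fin n → X × Bool) → X → Bool,
    Measurable (fun p : (Fin n → X × Bool) × X => A p.1 p.2) ∧
    ∀ s : Fin n → X × Bool, (∃ h ∈ H, ∀ j, h (s j).1 = (s j).2) →
      A s ∈ H ∧ ∀ j, A s (s j).1 = (s j).2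

/-! ## Distributed protocols -/

/-- The public record of one round: the bits sent by the center, the labelled examples sent by
each player, and the bits sent by each player. -/
structure RoundRecord (X : Type u) (k centerBits playerBits : ℕ) where
  center : Fin centerBits → Bool
  examples : Fin k → List (X × Bool)
  bits : Fin k → Fin playerBits → Bool

/-- A randomized broadcast protocol for a center and `k` players. Player `i` privately holds
`sampleSize` labelled examples; the center holds no data; each party holds a private random seed,
all seeds being independent with law `seedLaw`. In each round the center first broadcasts
`centerBits` bits, depending on the transcript so far and its own seed. Then all players
simultaneously broadcast examples of their own samples and `playerBits` bits each, depending on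
the transcript so far, the center's bits, their own sample and their own seed. The number of
examples that a player sends is publicly determined beforehand, and the bit messages have fixed
lengths, so that no information is conveyed by the length or by the absence of a message. After
the last round the hypothesis is read off the public transcript, so that every player and the
center know it. -/
structure Protocol (X : Type u) (k : ℕ) where
  rounds : ℕ
  sampleSize : ℕ
  centerBits : ℕ
  playerBits : ℕ
  Seed : Type
  seedSpace : MeasurableSpace Seed
  seedLaw : Measure Seed
  seedLaw_prob : IsProbabilityMeasure seedLaw
  /-- The center's message in the current round. -/
  centerMsg : List (RoundRecord X k centerBits playerBits) → Seed → Fin centerBits → Bool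
  /-- The number of examples that each player has to send in the current round. -/
  request : List (RoundRecord X k centerBits playerBits) → (Fin centerBits → Bool) → Fin k → ℕ
  /-- The positions, in its own sample, of the examples that player `i` sends. -/
  pick : (i : Fin k) → List (RoundRecord X k centerBits playerBits) → (Fin centerBits → Bool) →
    (Fin sampleSize → X × Bool) → Seed → List (Fin sampleSize)
  length_pick : ∀ i τ c s ω, (pick i τ c s ω).length = request τ c i
  /-- The bits that player `i` sends. -/
  playerMsg : (i : Fin k) → List (RoundRecord X k centerBits playerBits) →
    (Fin centerBits → Bool) → (Fin sampleSize → X × Bool) → Seed → Fin playerBits → Bool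
  output : List (RoundRecord X k centerBits playerBits) → X → Bool

namespace Protocol

variable {X : Type u} {k : ℕ}

/-- The elementary outcomes: the sampled points of all players, the seed of the center and the
seeds of the players. -/
abbrev Outcome (π : Protocol X k) : Type u :=
  (Fin k → Fin π.sampleSize → X) × (π.Seed × (Fin k → π.Seed))

/-- The labelled sample of player `i` when the target function is `f`. -/
def sample (π : Protocol X k) (f : X → Bool) (ω : π.Outcome) (i : Fin k) :
    Fin π.sampleSize → X × Bool :=
  fun j => (ω.1 i j, f (ω.1 i j))

/-- The transcript after `n` rounds, the most recent round first. -/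
def transcript (π : Protocol X k) (f : X → Bool) (ω : π.Outcome) :
    ℕ → List (RoundRecord X k π.centerBits π.playerBits)
  | 0 => []
  | n + 1 =>
    let τ := π.transcript f ω n
    let c := π.centerMsg τ ω.2.1
    { center := c
      examples := fun i =>
        (π.pick i τ c (π.sample f ω i) (ω.2.2 i)).map (π.sample f ω i)
      bits := fun i => π.playerMsg i τ c (π.sample f ω i) (ω.2.2 i) } :: τ

/-- The hypothesis that the protocol produces. -/
def hypothesis (π : Protocol X k) (f : X → Bool) (ω : π.Outcome) : X → Bool :=
  π.output (π.transcript f ω π.rounds)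

/-- The law of the outcomes: player `i` draws independent points from `D i`; the seeds are
independent of each other and of the data. -/
noncomputable def law [MeasurableSpace X] (π : Protocol X k) (D : Fin k → Measure X) :
    @Measure π.Outcome
      (@Prod.instMeasurableSpace _ _ MeasurableSpace.pi
        (@Prod.instMeasurableSpace _ _ π.seedSpace
          (@MeasurableSpace.pi _ _ fun _ => π.seedSpace))) :=
  letI := π.seedSpace
  (Measure.pi fun i : Fin k => Measure.pi fun _ : Fin π.sampleSize => D i).prod
    (π.seedLaw.prod (Measure.pi fun _ : Fin k => π.seedLaw))

/-- The joint mixture `(1/k) ∑ i, D i`. -/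
noncomputable def mixture [MeasurableSpace X] (D : Fin k → Measure X) : Measure X :=
  (k : ℝ≥0∞)⁻¹ • ∑ i, D i

/-- `π` learns `H` to error `ε` with confidence `1 - δ`: whatever the players' distributions and
the target in `H`, with probability at least `1 - δ` the hypothesis has error at most `ε` over
the joint mixture. (If the failure event is not measurable, its outer measure is bounded.) -/
def Learns [MeasurableSpace X] (π : Protocol X k) (H : Set (X → Bool)) (ε δ : ℝ) : Prop :=
  ∀ D : Fin k → Measure X, (∀ i, IsProbabilityMeasure (D i)) → ∀ f ∈ H,
    π.law D {ω | ENNReal.ofReal ε < mixture D {x | π.hypothesis f ω x ≠ f x}} ≤ ENNReal.ofReal δ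

end Protocol

/-- `H` can be learned by `k` players to error `ε` with confidence `1 - δ` in at most `R` rounds,
each of which communicates, over all parties together and in every execution, at most `E`
examples and at most `B` bits. -/
def LearnableWithin {X : Type u} [MeasurableSpace X] (H : Set (X → Bool)) (k : ℕ)
    (ε δ R E B : ℝ) : Prop :=
  ∃ π : Protocol X k,
    (π.rounds : ℝ) ≤ R ∧
    (∀ τ c, ((∑ i, π.request τ c i : ℕ) : ℝ) ≤ E) ∧
    ((π.centerBits + k * π.playerBits : ℕ) : ℝ) ≤ B ∧
    π.Learns H ε δ

/-! ## Weight-based boosting -/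

/-- A weight-based boosting algorithm that makes `r` calls to the weak learning oracle. The weight
of an example before call `t` depends solely on which of the `t` earlier hypotheses classify it
correctly (`true` means correct), and the distributions given to the oracle are proportional to the
weights. The final hypothesis combines the predictions of the `r` weak hypotheses. -/
structure WeightBooster (r : ℕ) where
  weight : (t : ℕ) → (Fin t → Bool) → ℝ
  weight_nonneg : ∀ t p, 0 ≤ weight t p
  combine : (Fin r → Bool) → Bool

namespace WeightBooster

variable {X : Type u} {r : ℕ}

/-- The weight of the example `x` with label `f x` before call `t`, when the oracle answers with
the hypotheses `h`. -/
def exampleWeight (B : WeightBooster r) (f : X → Bool) (h : Fin r → X → Bool) (t : Fin r)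
    (x : X) : ℝ :=
  B.weight t fun s : Fin t => h (Fin.castLE t.isLt.le s) x == f x

/-- `h` is a possible sequence of answers of a `β`-weak learning oracle on the sample `S` labelled
by `f`: each `h t` has error at most `β` on the current weighted distribution (if all current
weights vanish there is no such distribution, and any answer is allowed). -/
def WeakAnswers (B : WeightBooster r) (β : ℝ) (f : X → Bool) {N : ℕ} (S : Fin N → X)
    (h : Fin r → X → Bool) : Prop :=
  ∀ t : Fin r,
    ∑ j, (if h t (S j) ≠ f (S j) then B.exampleWeight f h t (S j) else 0) ≤
      β * ∑ j, B.exampleWeight f h t (S j)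

/-- The algorithm achieves error `ε` given a `β`-weak learning oracle for `H`: on every finite
sample labelled by a target in `H`, whatever the oracle's answers, the final hypothesis
misclassifies at most an `ε` fraction of the sample. -/
def Achieves (B : WeightBooster r) (H : Set (X → Bool)) (β ε : ℝ) : Prop :=
  ∀ f ∈ H, ∀ (N : ℕ) (S : Fin N → X) (h : Fin r → X → Bool), B.WeakAnswers β f S h →
    ((Finset.univ.filter fun j : Fin N =>
      B.combine (fun t => h t (S j)) ≠ f (S j)).card : ℝ) ≤ ε * N

end WeightBooster

end DistLearn

set_option autoImplicit false
set_option linter.unusedSectionVars false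
set_option linter.style.haveILetI false

namespace DistLearn

/-! All three bounds come from one boosting protocol. The players' private samples of size `m` are
pooled, and an example classified correctly `c` times so far has weight `2^(a(T-c))`, with `2^a`
about `1/β`. In each call the center allots `n` slots to the players in proportion to the binary
order of magnitude of their total weights. The players fill their slots by sampling from their own
weights, and the next hypothesis is one in the class that is consistent with the examples sent.
Rounding weights to powers of 2 costs a factor 2 in the sampling distribution, and makes the
messages short: per call, an order of magnitude drops by at most `a`.

Symmetrization and the Sauer–Shelah bound show that `n` of order `d a 2^a` makes the expected
weighted error about `2^(-a)`, so the total weight shrinks on average by `2/2^a` per call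
(`expect_totalWeight_callStep_le`). After `2τ` calls, an example on which the majority errs still
has weight at least `2^(aτ)`, so in expectation such examples form at most a fraction `(4/2^a)^τ` of
the sample (`expect_card_half_wrong_le`). Hence `τ` of order `log(1/ε)/log(1/β)` suffices for small
sample error. Generalization is a compression argument: the final vote is determined by few sample
positions, the other positions are fresh test points, and a union bound over the positions is
affordable because `m` is free (`measure_overfit_le`).

Parts 2 and 3 are the choices `β = 1/16` and `β = ε^(1/c)`, the latter with `1/16` in its place when
`ε^(1/c)` is larger. For part 1 the given booster is never run. An adversarial oracle shows that `r`
calls cannot achieve error below `⌈1/β⌉^(-r)` if the domain has more than `r` points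
(`WeightBooster.Achieves.one_le_mul_pow`), so the protocol above already needs only `O(r)` rounds.
On a domain with at most `r` points the players announce the labels point by point, one round each
(`learnableWithin_of_finite`). -/

/-! ### Expected error of a consistent hypothesis: Sauer–Shelah and symmetrization. -/

open Finset BigOperators in
theorem expect_extend {κ β α : Type*} [Fintype κ] [Fintype β] [Fintype α] [Nonempty α]
    [DecidableEq κ] [DecidableEq β]
    {e : β → κ} (he : Function.Injective e) (F : (κ → α) → ℝ) :
    𝔼 g, F g = 𝔼 g₀ : κ → α, 𝔼 v : β → α, F (Function.extend e v g₀) := by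
  classical
  have h1 : 𝔼 g₀ : κ → α, 𝔼 v : β → α, F (Function.extend e v g₀) =
      𝔼 p : (κ → α) × (β → α), F (Function.extend e p.2 p.1) := by
    rw [← univ_product_univ,
      expect_product univ univ fun p : (κ → α) × (β → α) => F (Function.extend e p.2 p.1)]
  have h2 : 𝔼 g, F g = 𝔼 p : (κ → α) × (β → α), F p.1 := by
    rw [← univ_product_univ, expect_product univ univ fun p : (κ → α) × (β → α) => F p.1]
    simp
  rw [h1, h2]
  -- Exchanging `v` with the values of `g` on the range of `e` is an involution.
  refine Fintype.expect_bijective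
    (fun p : (κ → α) × (β → α) => (Function.extend e p.2 p.1, p.1 ∘ e)) ?_ _ _ ?_
  · refine Function.Involutive.bijective ?_
    rintro ⟨g, v⟩
    refine Prod.ext (funext fun x => ?_) (funext fun x => ?_)
    · by_cases hx : ∃ b, e b = x
      · obtain ⟨b, rfl⟩ := hx
        simp [he.extend_apply]
      · simp [Function.extend_apply' _ _ _ hx]
    · simp [he.extend_apply]
  · rintro ⟨g, v⟩
    congr 1
    funext x
    by_cases hx : ∃ b, e b = x
    · obtain ⟨b, rfl⟩ := hx
      simp [he.extend_apply]
    · simp [Function.extend_apply' _ _ _ hx]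

open Finset BigOperators in
/-- The Sauer–Shelah bound on the number of traces of a class on a finite family of points. -/
theorem card_traces_le {ι I : Type*} [Fintype I] [DecidableEq I] {A : Set (ι → Bool)} {d : ℕ}
    (hA : ∀ s : Finset ι, Shatters A s → s.card ≤ d) (y : I → ι) (F : Finset (Finset I))
    (hF : ∀ v ∈ F, ∃ b ∈ A, ∀ i, i ∈ v ↔ b (y i) = true) :
    F.card ≤ ∑ i ∈ range (d + 1), (Fintype.card I).choose i := by
  classical
  refine (card_le_card_shatterer F).trans (card_shatterer_le_sum_vcDim.trans ?_)
  have hd : F.vcDim ≤ d := by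
    refine Finset.sup_le fun s hs => ?_
    rw [mem_shatterer] at hs
    -- Equal points receive equal bits, so a shattered set of indices lists distinct points.
    have hinj : Set.InjOn y s := by
      intro i hi j hj hij
      by_contra hne
      obtain ⟨v, hv, hsv⟩ := hs (singleton_subset_iff.2 hi)
      obtain ⟨b, -, hb⟩ := hF v hv
      have h1 : i ∈ s ∩ v := by rw [hsv]; simp
      have h2 : j ∉ s ∩ v := by rw [hsv]; simpa using Ne.symm hne
      have h3 : j ∉ v := fun h => h2 (mem_inter.2 ⟨hj, h⟩)
      exact h3 ((hb j).2 (hij ▸ (hb i).1 (mem_inter.1 h1).2))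
    have : Shatters A (s.image y) := by
      intro c
      obtain ⟨v, hv, hsv⟩ := hs (filter_subset (fun i => c (y i) = true) s)
      obtain ⟨b, hbA, hb⟩ := hF v hv
      refine ⟨b, hbA, fun x hx => ?_⟩
      obtain ⟨i, hi, rfl⟩ := mem_image.1 hx
      have h1 : i ∈ v ↔ c (y i) = true := by
        have := congrArg (i ∈ ·) hsv
        simpa [hi] using this
      have h2 := (hb i).symm.trans h1
      exact Bool.eq_iff_iff.2 h2
    calc s.card = (s.image y).card := (card_image_of_injOn hinj).symm
      _ ≤ d := hA _ this
  refine sum_le_sum_of_subset fun i hi => ?_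
  simp only [mem_Iic, mem_range] at hi ⊢
  omega

-- Let `M` be the pairs whose second entry lies in `v` under one admissible `σ₀`. Flipping such a
-- pair would put a point of `v` first, so every admissible `σ` agrees with `σ₀` on `M`, which
-- leaves at most `2^(n - |M|)` choices.
open Finset BigOperators in
theorem card_forced_le {n : ℕ} (v : Finset (Fin n × Bool)) (m : ℕ) :
    ((univ.filter fun σ : Fin n → Bool => (∀ l, (l, σ l) ∉ v) ∧
      m ≤ (univ.filter fun l => (l, !σ l) ∈ v).card).card) * 2 ^ m ≤ 2 ^ n := by
  classical
  rcases (univ.filter fun σ : Fin n → Bool => (∀ l, (l, σ l) ∉ v) ∧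
      m ≤ (univ.filter fun l => (l, !σ l) ∈ v).card).eq_empty_or_nonempty with h | ⟨σ₀, hσ₀⟩
  · simp [h]
  simp only [mem_filter, mem_univ, true_and] at hσ₀
  set M := univ.filter fun l => (l, !σ₀ l) ∈ v with hM
  have hsub : (univ.filter fun σ : Fin n → Bool => (∀ l, (l, σ l) ∉ v) ∧
      m ≤ (univ.filter fun l => (l, !σ l) ∈ v).card) ⊆
      Fintype.piFinset fun l => if l ∈ M then {σ₀ l} else univ := by
    intro σ hσ
    simp only [mem_filter, mem_univ, true_and] at hσ
    rw [Fintype.mem_piFinset]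
    intro l
    split_ifs with hl
    · rw [mem_singleton]
      by_contra hne
      have : σ l = !σ₀ l := by
        revert hne; cases σ l <;> cases σ₀ l <;> simp
      exact hσ.1 l (this ▸ (mem_filter.1 hl).2)
    · exact mem_univ _
  have hcard := card_le_card hsub
  rw [Fintype.card_piFinset] at hcard
  have hprod : (∏ l, (if l ∈ M then ({σ₀ l} : Finset Bool) else univ).card) * 2 ^ M.card = 2 ^ n := by
    have h1 : (2 : ℕ) ^ M.card = ∏ l, if l ∈ M then 2 else 1 := by
      rw [prod_ite]; simp
    rw [h1, ← prod_mul_distrib]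
    calc _ = ∏ _l : Fin n, 2 := prod_congr rfl fun l _ => by split_ifs <;> simp
      _ = 2 ^ n := by simp
  calc _ ≤ (∏ l, (if l ∈ M then ({σ₀ l} : Finset Bool) else univ).card) * 2 ^ M.card :=
        Nat.mul_le_mul hcard (Nat.pow_le_pow_right (by norm_num) hσ₀.2)
    _ = 2 ^ n := hprod

/-- Swap the two entries of `z l` for those `l` with `σ l = true`. -/
def swapAt {Ω : Type*} {n : ℕ} (σ : Fin n → Bool) (z : Fin n → Ω × Ω) : Fin n → Ω × Ω :=
  fun l => if σ l then (z l).swap else z l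

theorem swapAt_involutive {Ω : Type*} {n : ℕ} (σ : Fin n → Bool) :
    Function.Involutive (swapAt (Ω := Ω) σ) := by
  intro z; funext l; simp only [swapAt]; split_ifs <;> simp

-- For a fixed double sample only the traces of the class on its `2n` points matter. There are few
-- by Sauer–Shelah, and each one is bad for a fraction at most `2^(-m)` of the swaps.
open Finset BigOperators in
open scoped Classical in
theorem expect_bad_swap_le {Ω ι : Type*} {A : Set (ι → Bool)} {d : ℕ}
    (hA : ∀ s : Finset ι, Shatters A s → s.card ≤ d) (y : Ω → ι) {n : ℕ} (m : ℕ)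
    (z : Fin n → Ω × Ω) :
    (𝔼 σ : Fin n → Bool, if ∃ b ∈ A, (∀ l, b (y (swapAt σ z l).1) = false) ∧
      m ≤ (univ.filter fun l => b (y (swapAt σ z l).2) = true).card then (1 : ℝ) else 0) ≤
    (∑ i ∈ range (d + 1), (2 * n).choose i : ℕ) / 2 ^ m := by
  let pt : Fin n × Bool → Ω := fun q => if q.2 then (z q.1).2 else (z q.1).1
  let F : Finset (Finset (Fin n × Bool)) :=
    univ.filter fun v => ∃ b ∈ A, ∀ q, q ∈ v ↔ b (y (pt q)) = true
  have hFcard : F.card ≤ ∑ i ∈ range (d + 1), (2 * n).choose i := by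
    have := card_traces_le hA (y ∘ pt) F fun v hv => (mem_filter.1 hv).2
    simpa [mul_comm] using this
  have hp1 : ∀ σ : Fin n → Bool, ∀ l, (swapAt σ z l).1 = pt (l, σ l) := by
    intro σ l; simp only [swapAt, pt]; cases σ l <;> simp
  have hp2 : ∀ σ : Fin n → Bool, ∀ l, (swapAt σ z l).2 = pt (l, !σ l) := by
    intro σ l; simp only [swapAt, pt]; cases σ l <;> simp
  rw [Fintype.expect_eq_sum_div_card, sum_boole]
  have hsub : (univ.filter fun σ : Fin n → Bool => ∃ b ∈ A, (∀ l, b (y (swapAt σ z l).1) = false) ∧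
      m ≤ (univ.filter fun l => b (y (swapAt σ z l).2) = true).card) ⊆
      F.biUnion fun v => univ.filter fun σ : Fin n → Bool => (∀ l, (l, σ l) ∉ v) ∧
        m ≤ (univ.filter fun l => (l, !σ l) ∈ v).card := by
    intro σ hσ
    obtain ⟨b, hb, h1, h2⟩ := (mem_filter.1 hσ).2
    refine mem_biUnion.2 ⟨univ.filter fun q => b (y (pt q)) = true,
      mem_filter.2 ⟨mem_univ _, b, hb, by simp⟩, mem_filter.2 ⟨mem_univ _, ?_, ?_⟩⟩
    · intro l
      simp [← hp1, h1 l]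
    · simpa [← hp2] using h2
  have hcard := (card_le_card hsub).trans card_biUnion_le
  have h2 : (univ.filter fun σ : Fin n → Bool => ∃ b ∈ A, (∀ l, b (y (swapAt σ z l).1) = false) ∧
      m ≤ (univ.filter fun l => b (y (swapAt σ z l).2) = true).card).card * 2 ^ m ≤
      (∑ i ∈ range (d + 1), (2 * n).choose i) * 2 ^ n := by
    calc _ ≤ (∑ v ∈ F, (univ.filter fun σ : Fin n → Bool => (∀ l, (l, σ l) ∉ v) ∧
        m ≤ (univ.filter fun l => (l, !σ l) ∈ v).card).card) * 2 ^ m :=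
          Nat.mul_le_mul_right _ hcard
      _ ≤ ∑ v ∈ F, 2 ^ n := by
          rw [sum_mul]; exact sum_le_sum fun v _ => card_forced_le v m
      _ = F.card * 2 ^ n := by simp
      _ ≤ _ := Nat.mul_le_mul_right _ hFcard
  have h3 : (Fintype.card (Fin n → Bool) : ℝ) = 2 ^ n := by simp
  rw [h3, div_le_div_iff₀ (by positivity) (by positivity)]
  exact_mod_cast h2

-- Swapping entries within pairs preserves the uniform law, so the average over swaps may be taken
-- first, with the double sample fixed.
open Finset BigOperators in
open scoped Classical in
theorem expect_bad_pair_le {Ω ι : Type*} [Fintype Ω] [Nonempty Ω] {A : Set (ι → Bool)} {d : ℕ}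
    (hA : ∀ s : Finset ι, Shatters A s → s.card ≤ d) (y : Ω → ι) {n : ℕ} (m : ℕ) :
    (𝔼 z : Fin n → Ω × Ω, if ∃ b ∈ A, (∀ l, b (y (z l).1) = false) ∧
      m ≤ (univ.filter fun l => b (y (z l).2) = true).card then (1 : ℝ) else 0) ≤
    (∑ i ∈ range (d + 1), (2 * n).choose i : ℕ) / 2 ^ m := by
  set G : (Fin n → Ω × Ω) → ℝ := fun z => if ∃ b ∈ A, (∀ l, b (y (z l).1) = false) ∧
      m ≤ (univ.filter fun l => b (y (z l).2) = true).card then (1 : ℝ) else 0 with hG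
  have h1 : 𝔼 z, G z = 𝔼 σ : Fin n → Bool, 𝔼 z, G (swapAt σ z) := by
    have : ∀ σ : Fin n → Bool, 𝔼 z, G (swapAt σ z) = 𝔼 z, G z := fun σ =>
      Fintype.expect_bijective _ (swapAt_involutive σ).bijective _ _ fun _ => rfl
    simp [this]
  rw [h1, expect_comm]
  calc _ ≤ 𝔼 _z : Fin n → Ω × Ω, ((∑ i ∈ range (d + 1), (2 * n).choose i : ℕ) / 2 ^ m : ℝ) :=
        expect_le_expect fun z _ => expect_bad_swap_le hA y m z
    _ = _ := by simp

open Finset BigOperators in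
theorem expect_eval {Ω : Type*} [Fintype Ω] [Nonempty Ω] {n : ℕ} (l : Fin n) (F : Ω → ℝ) :
    𝔼 ω : Fin n → Ω, F (ω l) = 𝔼 x, F x := by
  classical
  have he : Function.Injective (fun _ : Unit => l) := fun _ _ _ => rfl
  rw [expect_extend he]
  have : ∀ (g₀ : Fin n → Ω) (v : Unit → Ω), Function.extend (fun _ : Unit => l) v g₀ l = v () :=
    fun g₀ v => he.extend_apply v g₀ ()
  simp only [this]
  rw [Fintype.expect_const]
  exact Fintype.expect_equiv (Equiv.funUnique Unit Ω) _ _ fun _ => rfl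

open Finset BigOperators in
/-- Expected error of a hypothesis that is consistent with an independent sample. Hypotheses are
recorded by their error bits. -/
theorem expect_error_consistent_le {Ω ι : Type*} [Fintype Ω] [Nonempty Ω] {A : Set (ι → Bool)}
    {d : ℕ} (hA : ∀ s : Finset ι, Shatters A s → s.card ≤ d) (y : Ω → ι) {n : ℕ} (hn : 0 < n)
    (m : ℕ) (sel : (Fin n → Ω) → ι → Bool) (hsel : ∀ ω, sel ω ∈ A)
    (hcons : ∀ ω l, sel ω (y (ω l)) = false) :
    (𝔼 ω, 𝔼 x, if sel ω (y x) = true then (1 : ℝ) else 0) ≤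
      m / n + (∑ i ∈ range (d + 1), (2 * n).choose i : ℕ) / 2 ^ m := by
  classical
  have hn' : (0 : ℝ) < n := by exact_mod_cast hn
  -- Ghost sample: the true error is the mean error frequency on an independent second sample `ω'`.
  -- Fewer than `m` errors there contribute at most `m / n`; otherwise the bad event of
  -- `expect_bad_pair_le` occurs. That event quantifies over all of `A`, so `sel` may depend on `ω`
  -- in any way.
  have h1 : ∀ ω, (𝔼 x, if sel ω (y x) = true then (1 : ℝ) else 0) =
      𝔼 ω' : Fin n → Ω, (∑ l, if sel ω (y (ω' l)) = true then (1 : ℝ) else 0) / n := by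
    intro ω
    rw [← expect_div, expect_sum_comm]
    simp only [expect_eval _ fun x => if sel ω (y x) = true then (1 : ℝ) else 0]
    simp [hn'.ne']
  simp only [h1]
  have h2 : ∀ ω ω' : Fin n → Ω, (∑ l, if sel ω (y (ω' l)) = true then (1 : ℝ) else 0) / n ≤
      m / n + if ∃ b ∈ A, (∀ l, b (y (ω l)) = false) ∧
      m ≤ (univ.filter fun l => b (y (ω' l)) = true).card then (1 : ℝ) else 0 := by
    intro ω ω'
    rw [sum_boole]
    split_ifs with h
    · have : ((univ.filter fun l => sel ω (y (ω' l)) = true).card : ℝ) ≤ n := by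
        exact_mod_cast (card_filter_le _ _).trans (by simp)
      have h3 : ((univ.filter fun l => sel ω (y (ω' l)) = true).card : ℝ) / n ≤ 1 :=
        (div_le_one hn').2 this
      have h4 : (0 : ℝ) ≤ m / n := by positivity
      linarith
    · have : ¬ m ≤ (univ.filter fun l => sel ω (y (ω' l)) = true).card := fun hm =>
        h ⟨_, hsel ω, hcons ω, hm⟩
      have h3 : ((univ.filter fun l => sel ω (y (ω' l)) = true).card : ℝ) ≤ m := by
        exact_mod_cast (not_le.1 this).le
      rw [add_zero]
      gcongr
  calc _ ≤ 𝔼 ω : Fin n → Ω, 𝔼 ω' : Fin n → Ω, ((m : ℝ) / n +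
        if ∃ b ∈ A, (∀ l, b (y (ω l)) = false) ∧
        m ≤ (univ.filter fun l => b (y (ω' l)) = true).card then (1 : ℝ) else 0) :=
        expect_le_expect fun ω _ => expect_le_expect fun ω' _ => h2 ω ω'
    _ = m / n + 𝔼 ω : Fin n → Ω, 𝔼 ω' : Fin n → Ω,
        (if ∃ b ∈ A, (∀ l, b (y (ω l)) = false) ∧
        m ≤ (univ.filter fun l => b (y (ω' l)) = true).card then (1 : ℝ) else 0) := by
        simp only [expect_add_distrib, Fintype.expect_const]
    _ ≤ _ := by
        gcongr
        refine le_trans (le_of_eq ?_) (expect_bad_pair_le hA y (n := n) m)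
        rw [← expect_product', univ_product_univ]
        exact (Fintype.expect_equiv (Equiv.arrowProdEquivProdArrow (Fin n) (fun _ => Ω) (fun _ => Ω))
          _ _ fun z => rfl).symm

open Finset BigOperators in
/-- `∑_{i ≤ d} C(N, i) ≤ (e N / d)^d`. -/
theorem sum_choose_le {d N : ℕ} (hd : 0 < d) (hN : d ≤ N) :
    ((∑ i ∈ range (d + 1), N.choose i : ℕ) : ℝ) ≤ (Real.exp 1 * (N / d)) ^ d := by
  have hd' : (0 : ℝ) < d := by exact_mod_cast hd
  have hN' : (0 : ℝ) < N := by exact_mod_cast hd.trans_le hN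
  have hx0 : (0 : ℝ) < d / N := by positivity
  have hx1 : (d : ℝ) / N ≤ 1 := (div_le_one hN').2 (by exact_mod_cast hN)
  -- For `i ≤ d` the factor `(d/N)^d` is at most `(d/N)^i`, which completes the sum to the expansion
  -- of `(1 + d/N)^N ≤ e^d`.
  have h1 : ((∑ i ∈ range (d + 1), N.choose i : ℕ) : ℝ) * ((d : ℝ) / N) ^ d ≤
      ∑ i ∈ range (N + 1), ((d : ℝ) / N) ^ i * 1 ^ (N - i) * N.choose i := by
    push_cast
    rw [sum_mul]
    calc _ ≤ ∑ i ∈ range (d + 1), ((d : ℝ) / N) ^ i * 1 ^ (N - i) * N.choose i := by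
          refine sum_le_sum fun i hi => ?_
          rw [one_pow, mul_one, mul_comm]
          gcongr ?_ * _
          exact pow_le_pow_of_le_one hx0.le hx1 (by simp at hi; omega)
      _ ≤ _ := sum_le_sum_of_subset_of_nonneg (range_mono (by omega)) fun i _ _ => by positivity
  rw [← add_pow] at h1
  have h2 : ((d : ℝ) / N + 1) ^ N ≤ Real.exp 1 ^ d := by
    calc _ ≤ (Real.exp (d / N)) ^ N := by
          gcongr; exact Real.add_one_le_exp _
      _ = Real.exp 1 ^ d := by
          rw [← Real.exp_nat_mul, ← Real.exp_nat_mul]; congr 1; field_simp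
  have h3 : (Real.exp 1 * (N / d)) ^ d * ((d : ℝ) / N) ^ d = Real.exp 1 ^ d := by
    rw [← mul_pow]; congr 1; field_simp
  exact le_of_mul_le_mul_right ((h1.trans h2).trans_eq h3.symm) (by positivity)

end DistLearn

namespace DistLearn

open Finset BigOperators

/-! ## Sampling from natural weights with a uniform seed -/

/-- When the total weight divides `L`, the seeds can be cut into equal blocks, so exact weighted
sampling from a uniform seed is possible without rounding. -/
theorem exists_sampler {m L : ℕ} (w : Fin m → ℕ) (hL : ∑ j, w j ∣ L) :
    ∃ g : Fin L → Fin m, ∀ j,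
      (univ.filter fun x => g x = j).card * ∑ j, w j = w j * L := by
  obtain ⟨q, rfl⟩ := hL
  let e : Fin ((∑ j, w j) * q) ≃ (Σ j : Fin m, Fin (w j)) × Fin q :=
    finProdFinEquiv.symm.trans (Equiv.prodCongr finSigmaFinEquiv.symm (Equiv.refl _))
  refine ⟨fun x => (e x).1.1, fun j => ?_⟩
  have h1 : (univ.filter fun x => (e x).1.1 = j).card = w j * q := by
    have h2 : (univ.filter fun x => (e x).1.1 = j).card =
        (univ.filter fun p : (Σ j : Fin m, Fin (w j)) × Fin q => p.1.1 = j).card := by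
      refine card_bij (fun x _ => e x) (by simp) (fun x _ y _ h => e.injective h) fun p hp => ?_
      exact ⟨e.symm p, by simpa using hp, by simp⟩
    have h3 : (univ.filter fun p : (Σ j : Fin m, Fin (w j)) × Fin q => p.1.1 = j) =
        (univ.image fun x : Fin (w j) × Fin q => ((⟨j, x.1⟩ : Σ j : Fin m, Fin (w j)), x.2)) := by
      ext ⟨⟨i, x⟩, y⟩
      simp only [mem_filter, mem_univ, true_and, mem_image, Prod.mk.injEq, Prod.exists]
      constructor
      · rintro rfl; exact ⟨x, y, rfl, rfl⟩
      · rintro ⟨a, b, h, -⟩; exact (Sigma.mk.inj_iff.1 h).1.symm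
    rw [h2, h3, card_image_of_injective]
    · simp
    · rintro ⟨x, y⟩ ⟨x', y'⟩ h
      simpa using h
  rw [h1]; ring

open scoped Classical in
/-- A map whose fibres over a uniform seed have sizes proportional to the weights. -/
noncomputable def sampler {m : ℕ} [NeZero m] (L : ℕ) (w : Fin m → ℕ) : Fin L → Fin m :=
  if h : ∃ g : Fin L → Fin m, ∀ j,
    (univ.filter fun x => g x = j).card * ∑ j, w j = w j * L then h.choose else fun _ => 0

theorem expect_sampler {m : ℕ} [NeZero m] {L : ℕ} (hL0 : 0 < L) (w : Fin m → ℕ)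
    (hw : 0 < ∑ j, w j) (hL : ∑ j, w j ∣ L) (F : Fin m → ℝ) :
    𝔼 x, F (sampler L w x) = (∑ j, w j * F j) / (∑ j, w j : ℕ) := by
  have hg : ∀ j, (univ.filter fun x => sampler L w x = j).card * ∑ j, w j = w j * L := by
    have h := exists_sampler w hL
    unfold sampler
    rw [dif_pos h]
    exact h.choose_spec
  have hL' : (0 : ℝ) < L := by exact_mod_cast hL0
  have hw' : (0 : ℝ) < (∑ j, w j : ℕ) := by exact_mod_cast hw
  rw [Fintype.expect_eq_sum_div_card, div_eq_div_iff (by simpa using hL0.ne') hw'.ne',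
    ← sum_fiberwise univ (sampler L w) fun x => F (sampler L w x), Fintype.card_fin, sum_mul,
    sum_mul]
  refine sum_congr rfl fun j _ => ?_
  have h1 : ∑ x ∈ univ.filter (fun x => sampler L w x = j), F (sampler L w x) =
      (univ.filter fun x => sampler L w x = j).card * F j := by
    rw [sum_congr rfl fun x hx => by rw [(mem_filter.1 hx).2], sum_const, nsmul_eq_mul]
  rw [h1]
  have h2 : ((univ.filter fun x => sampler L w x = j).card : ℝ) * (∑ j, w j : ℕ) = w j * L := by
    exact_mod_cast hg j
  linear_combination F j * h2

/-! ## The boosting process on a fixed sample -/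

section BoostProcess

variable {k m : ℕ} [NeZero k] [NeZero m]

/-- The weights of the examples of one player, given how often each was classified correctly. -/
def localWeight (T a : ℕ) (c : Fin m → ℕ) (j : Fin m) : ℕ := 2 ^ (a * (T - c j))

/-- The binary order of magnitude of the total weight of one player. -/
def logWeight (T a : ℕ) (c : Fin m → ℕ) : ℕ := Nat.log 2 (∑ j, localWeight T a c j)

/-- The players that the center samples for the slots. -/
noncomputable def slotPlayer {n L : ℕ} (e : Fin k → ℕ) (α : Fin n → Fin L) (l : Fin n) : Fin k :=
  sampler L (fun i => 2 ^ e i) (α l)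

/-- The number of slots given to each player. -/
noncomputable def slotCount {n L : ℕ} (e : Fin k → ℕ) (α : Fin n → Fin L) (i : Fin k) : ℕ :=
  (univ.filter fun l => slotPlayer e α l = i).card

/-- The number of earlier slots of the same player. -/
noncomputable def slotRank {n L : ℕ} (e : Fin k → ℕ) (α : Fin n → Fin L) (l : Fin n) : ℕ :=
  (univ.filter fun l' => l' < l ∧ slotPlayer e α l' = slotPlayer e α l).card

/-- The positions that a player would pick, in its own sample, with a given seed. -/
noncomputable def localPicks {n L : ℕ} (T a : ℕ) (c : Fin m → ℕ) (ω : Fin n → Fin L) (q : ℕ) :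
    List (Fin m) :=
  (List.ofFn fun r => sampler L (localWeight T a c) (ω r)).take q

/-- The positions of all the examples sent in one call, listed player by player. -/
noncomputable def jointPicks {n L : ℕ} (T a : ℕ) (c : Fin k × Fin m → ℕ) (α : Fin n → Fin L)
    (g : Fin k → Fin n → Fin L) : List (Fin k × Fin m) :=
  (List.finRange k).flatMap fun i =>
    (localPicks T a (fun j => c (i, j)) (g i)
      (slotCount (fun i => logWeight T a fun j => c (i, j)) α i)).map fun j => (i, j)

theorem slotRank_lt {n L : ℕ} (e : Fin k → ℕ) (α : Fin n → Fin L) (l : Fin n) :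
    slotRank e α l < slotCount e α (slotPlayer e α l) := by
  refine card_lt_card (Finset.ssubset_iff_of_subset ?_ |>.2 ⟨l, by simp, by simp⟩)
  intro l' h
  simp only [mem_filter, mem_univ, true_and] at h ⊢
  exact h.2

theorem slotCount_le {n L : ℕ} (e : Fin k → ℕ) (α : Fin n → Fin L) (i : Fin k) :
    slotCount e α i ≤ n := (card_filter_le _ _).trans (by simp)

theorem sum_slotCount {n L : ℕ} (e : Fin k → ℕ) (α : Fin n → Fin L) :
    ∑ i, slotCount e α i = n := by
  have := card_eq_sum_card_fiberwise (f := slotPlayer e α) (s := univ) (t := univ) (by simp)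
  simpa [slotCount] using this.symm

/-- The seed used for a slot: the player and the number of the pick. -/
noncomputable def slotKey {n L : ℕ} (e : Fin k → ℕ) (α : Fin n → Fin L) (l : Fin n) :
    Fin k × Fin n :=
  (slotPlayer e α l, ⟨slotRank e α l, (slotRank_lt e α l).trans_le (slotCount_le e α _)⟩)

/-- Two slots of the same player have different ranks. Thus no seed serves two slots, which is the
source of the independence of the picks. -/
theorem slotKey_injective {n L : ℕ} (e : Fin k → ℕ) (α : Fin n → Fin L) :
    Function.Injective (slotKey e α) := by
  have key : ∀ l l', slotPlayer e α l = slotPlayer e α l' → l < l' →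
      slotRank e α l < slotRank e α l' := by
    intro l l' hp hl
    refine card_lt_card (Finset.ssubset_iff_of_subset ?_ |>.2 ⟨l, by simp [hp, hl], by simp⟩)
    intro x h
    simp only [mem_filter, mem_univ, true_and] at h ⊢
    exact ⟨h.1.trans hl, h.2.trans hp⟩
  intro l l' h
  have h1 : slotPlayer e α l = slotPlayer e α l' := congrArg Prod.fst h
  have h2 : slotRank e α l = slotRank e α l' := congrArg (fun p => (Prod.snd p).val) h
  rcases lt_trichotomy l l' with hl | hl | hl
  · exact absurd h2 (key _ _ h1 hl).ne
  · exact hl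
  · exact absurd h2 (key _ _ h1.symm hl).ne'

theorem length_localPicks {n L : ℕ} (T a : ℕ) (c : Fin m → ℕ) (ω : Fin n → Fin L) {q : ℕ}
    (hq : q ≤ n) : (localPicks T a c ω q).length = q := by
  simp [localPicks, hq]

theorem length_jointPicks {n L : ℕ} (T a : ℕ) (c : Fin k × Fin m → ℕ) (α : Fin n → Fin L)
    (g : Fin k → Fin n → Fin L) : (jointPicks T a c α g).length = n := by
  rw [jointPicks, List.length_flatMap]
  simp only [List.length_map, length_localPicks _ _ _ _ (slotCount_le _ _ _)]
  rw [← Fin.sum_univ_def]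
  exact sum_slotCount _ α

/-- The positions of the examples sent in one call, as a family. -/
noncomputable def callPicks {n L : ℕ} (T a : ℕ) (c : Fin k × Fin m → ℕ) (α : Fin n → Fin L)
    (g : Fin k → Fin n → Fin L) (l : Fin n) : Fin k × Fin m :=
  (jointPicks T a c α g).get (l.cast (length_jointPicks T a c α g).symm)

/-- The example sampled for a slot, as a function of the slot's seeds. -/
noncomputable def slotExample {L : ℕ} (T a : ℕ) (c : Fin k × Fin m → ℕ) (x : Fin L × Fin L) :
    Fin k × Fin m :=
  let i := sampler L (fun i => 2 ^ logWeight T a fun j => c (i, j)) x.1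
  (i, sampler L (localWeight T a fun j => c (i, j)) x.2)

/-- Examples are listed player by player, so the order of the slots is lost. Consistency only needs
every slot's example to occur somewhere in the list. -/
theorem slotExample_mem_callPicks {n L : ℕ} (T a : ℕ) (c : Fin k × Fin m → ℕ)
    (α : Fin n → Fin L) (g : Fin k → Fin n → Fin L) (l : Fin n) :
    ∃ l', callPicks T a c α g l' = slotExample T a c (α l,
      (Function.uncurry g) (slotKey (fun i => logWeight T a fun j => c (i, j)) α l)) := by
  set e : Fin k → ℕ := fun i => logWeight T a fun j => c (i, j) with he
  have hmem : slotExample T a c (α l, (Function.uncurry g) (slotKey e α l)) ∈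
      jointPicks T a c α g := by
    rw [jointPicks, List.mem_flatMap]
    refine ⟨slotPlayer e α l, List.mem_finRange _, List.mem_map.2
      ⟨sampler L (localWeight T a fun j => c (slotPlayer e α l, j))
        (Function.uncurry g (slotKey e α l)), ?_, rfl⟩⟩
    rw [localPicks, List.mem_take_iff_getElem]
    have hr := slotRank_lt e α l
    have hc := slotCount_le e α (slotPlayer e α l)
    refine ⟨slotRank e α l, ?_, ?_⟩
    · rw [List.length_ofFn]; exact lt_min hr (hr.trans_le hc)
    · simp [slotKey, Function.uncurry]
  obtain ⟨q, hq⟩ := List.get_of_mem hmem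
  refine ⟨q.cast (length_jointPicks T a c α g), ?_⟩
  rw [← hq]
  rfl

/-- Update of the numbers of correct classifications after one call. The table `tab` lists the
error bits, on the whole sample, of the hypothesis obtained from given positions. -/
noncomputable def callStep {n L : ℕ} (tab : (Fin n → Fin k × Fin m) → Fin k × Fin m → Bool)
    (T a : ℕ) (c : Fin k × Fin m → ℕ) (r : (Fin n → Fin L) × (Fin k → Fin n → Fin L)) :
    Fin k × Fin m → ℕ :=
  fun p => c p + if tab (callPicks T a c r.1 r.2) p then 0 else 1

/-- Total weight of the sample. -/
def totalWeight (T a : ℕ) (c : Fin k × Fin m → ℕ) : ℕ := ∑ p, 2 ^ (a * (T - c p))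

theorem sum_localWeight_pos (T a : ℕ) (c : Fin m → ℕ) : 0 < ∑ j, localWeight T a c j :=
  sum_pos (fun j _ => by unfold localWeight; positivity) univ_nonempty

theorem totalWeight_eq (T a : ℕ) (c : Fin k × Fin m → ℕ) :
    totalWeight T a c = ∑ i, ∑ j, localWeight T a (fun j => c (i, j)) j := by
  rw [totalWeight, ← univ_product_univ, sum_product]; rfl

theorem totalWeight_le (T a : ℕ) (c : Fin k × Fin m → ℕ) :
    totalWeight T a c ≤ k * m * 2 ^ (a * T) := by
  calc totalWeight T a c ≤ ∑ _p : Fin k × Fin m, 2 ^ (a * T) :=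
        sum_le_sum fun p _ => Nat.pow_le_pow_right (by norm_num) (Nat.mul_le_mul_left _ (by omega))
    _ = _ := by simp

theorem two_pow_logWeight_le (T a : ℕ) (c : Fin m → ℕ) :
    2 ^ logWeight T a c ≤ ∑ j, localWeight T a c j :=
  Nat.pow_log_le_self 2 (sum_localWeight_pos T a c).ne'

theorem le_two_mul_two_pow_logWeight (T a : ℕ) (c : Fin m → ℕ) :
    ∑ j, localWeight T a c j ≤ 2 * 2 ^ logWeight T a c := by
  have := Nat.lt_pow_succ_log_self (b := 2) (by norm_num) (∑ j, localWeight T a c j)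
  rw [pow_succ] at this
  unfold logWeight
  omega

/-- Up to a factor of 2, slots are filled according to the weights of the examples. -/
theorem sum_weight_le_expect_slotExample {T a L : ℕ} (hL0 : 0 < L)
    (hL : ∀ W, 0 < W → W ≤ k * m * 2 ^ (a * T) → W ∣ L) (c : Fin k × Fin m → ℕ)
    (b : Fin k × Fin m → ℝ) (hb : ∀ p, 0 ≤ b p) :
    ∑ p, (2 ^ (a * (T - c p)) : ℕ) * b p ≤
      2 * totalWeight T a c * 𝔼 x : Fin L × Fin L, b (slotExample T a c x) := by
  set W : Fin k → ℕ := fun i => ∑ j, localWeight T a (fun j => c (i, j)) j with hW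
  set e : Fin k → ℕ := fun i => logWeight T a fun j => c (i, j) with he
  have hWpos : ∀ i, 0 < W i := fun i => sum_localWeight_pos _ _ _
  have hWtot : ∑ i, W i = totalWeight T a c := (totalWeight_eq T a c).symm
  have hWle : ∀ i, W i ≤ k * m * 2 ^ (a * T) := fun i =>
    (single_le_sum (fun _ _ => Nat.zero_le _) (mem_univ i)).trans
      (hWtot.le.trans (totalWeight_le T a c))
  have hE : ∑ i, 2 ^ e i ≤ totalWeight T a c :=
    hWtot ▸ sum_le_sum fun i _ => two_pow_logWeight_le _ _ _
  have hEpos : 0 < ∑ i, 2 ^ e i := sum_pos (fun i _ => by positivity) univ_nonempty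
  have h1 : 𝔼 x : Fin L × Fin L, b (slotExample T a c x) =
      (∑ i, (2 ^ e i : ℕ) * ((∑ j, localWeight T a (fun j => c (i, j)) j * b (i, j)) / (W i : ℕ))) /
        (∑ i, 2 ^ e i : ℕ) := by
    rw [← univ_product_univ, expect_product univ univ fun x => b (slotExample T a c x)]
    have h3 : ∀ i : Fin k, 𝔼 β : Fin L, b (i, sampler L (localWeight T a fun j => c (i, j)) β) =
        (∑ j, localWeight T a (fun j => c (i, j)) j * b (i, j)) / (W i : ℕ) := fun i =>
      expect_sampler hL0 (localWeight T a fun j => c (i, j))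
        (hWpos i) (hL _ (hWpos i) (hWle i)) fun j => b (i, j)
    have h2 : ∀ α : Fin L, 𝔼 β : Fin L, b (slotExample T a c (α, β)) =
        (fun i => (∑ j, localWeight T a (fun j => c (i, j)) j * b (i, j)) / (W i : ℕ))
          (sampler L (fun i => 2 ^ e i) α) := fun α => h3 (sampler L (fun i => 2 ^ e i) α)
    simp only [h2]
    exact expect_sampler hL0 (fun i => 2 ^ e i) hEpos
      (hL _ hEpos (hE.trans (totalWeight_le T a c)))
      fun i => (∑ j, localWeight T a (fun j => c (i, j)) j * b (i, j)) / (W i : ℕ)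
  have hB : ∀ i, 0 ≤ (∑ j, localWeight T a (fun j => c (i, j)) j * b (i, j)) / (W i : ℝ) := fun i =>
    div_nonneg (sum_nonneg fun j _ => mul_nonneg (Nat.cast_nonneg _) (hb _)) (Nat.cast_nonneg _)
  rw [h1]
  have hE' : (0 : ℝ) < (∑ i, 2 ^ e i : ℕ) := by exact_mod_cast hEpos
  have hE2 : ((∑ i, 2 ^ e i : ℕ) : ℝ) ≤ totalWeight T a c := by exact_mod_cast hE
  -- Player `i` is drawn with probability `2^(e i) / ∑ 2^e`. The factor 2 pays for `W i ≤ 2 * 2^(e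
  -- i)`, and `∑ 2^e` is at most the total weight.
  calc ∑ p, ((2 ^ (a * (T - c p)) : ℕ) : ℝ) * b p
      = ∑ i, W i * ((∑ j, localWeight T a (fun j => c (i, j)) j * b (i, j)) / (W i : ℝ)) := by
        rw [← univ_product_univ, sum_product]
        refine sum_congr rfl fun i _ => ?_
        have : (W i : ℝ) ≠ 0 := by exact_mod_cast (hWpos i).ne'
        rw [mul_div_cancel₀ _ this]; rfl
    _ ≤ ∑ i, 2 * ((2 ^ e i : ℕ) *
          ((∑ j, localWeight T a (fun j => c (i, j)) j * b (i, j)) / (W i : ℝ))) := by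
        refine sum_le_sum fun i _ => ?_
        rw [← mul_assoc]
        refine mul_le_mul_of_nonneg_right ?_ (hB i)
        exact_mod_cast le_two_mul_two_pow_logWeight T a _
    _ = 2 * (∑ i, 2 ^ e i : ℕ) * ((∑ i, (2 ^ e i : ℕ) *
          ((∑ j, localWeight T a (fun j => c (i, j)) j * b (i, j)) / (W i : ℕ))) /
        (∑ i, 2 ^ e i : ℕ)) := by
        rw [← mul_sum]; field_simp
    _ ≤ _ := by
        gcongr
        exact div_nonneg (sum_nonneg fun i _ => mul_nonneg (Nat.cast_nonneg _) (hB i)) hE'.le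

/-- One call of the process shrinks the total weight in expectation. -/
theorem expect_totalWeight_callStep_le {T a L d n : ℕ} (hL0 : 0 < L) (hn : 0 < n)
    (hL : ∀ W, 0 < W → W ≤ k * m * 2 ^ (a * T) → W ∣ L)
    (tab : (Fin n → Fin k × Fin m) → Fin k × Fin m → Bool) {A : Set (Fin k × Fin m → Bool)}
    (hA : ∀ s : Finset (Fin k × Fin m), Shatters A s → s.card ≤ d) (htab : ∀ J, tab J ∈ A)
    (hcons : ∀ J l, tab J (J l) = false) (M : ℕ) (c : Fin k × Fin m → ℕ) (hc : ∀ p, c p < T) :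
    𝔼 r : (Fin n → Fin L) × (Fin k → Fin n → Fin L), (totalWeight T a (callStep tab T a c r) : ℝ) ≤
      ((2 ^ a)⁻¹ + 2 * (M / n + (∑ i ∈ range (d + 1), (2 * n).choose i : ℕ) / 2 ^ M)) *
        totalWeight T a c := by
  haveI : Nonempty (Fin L) := ⟨⟨0, hL0⟩⟩
  set Φ : ℝ := (totalWeight T a c : ℝ) with hΦ
  set γ : ℝ := M / n + (∑ i ∈ range (d + 1), (2 * n).choose i : ℕ) / 2 ^ M with hγ
  -- Correct examples lose a factor `2^a` and the others keep their weight. So the new total is at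
  -- most `2^(-a) Φ` plus the misclassified weight, which is compared with the error under the slot
  -- distribution.
  have hstep : ∀ r : (Fin n → Fin L) × (Fin k → Fin n → Fin L),
      (totalWeight T a (callStep tab T a c r) : ℝ) ≤ (2 ^ a)⁻¹ * Φ +
        2 * Φ * 𝔼 x : Fin L × Fin L,
          if tab (callPicks T a c r.1 r.2) (slotExample T a c x) = true then (1 : ℝ) else 0 := by
    intro r
    have h1 := sum_weight_le_expect_slotExample hL0 hL c
      (fun p => if tab (callPicks T a c r.1 r.2) p = true then (1 : ℝ) else 0)
      (fun p => by split_ifs <;> norm_num)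
    refine le_trans ?_ (add_le_add_right h1 _)
    rw [hΦ, totalWeight, totalWeight]
    push_cast
    rw [mul_sum, ← sum_add_distrib]
    refine sum_le_sum fun p _ => ?_
    unfold callStep
    split_ifs with h
    · simp only [add_zero, mul_one]
      have : (0 : ℝ) ≤ (2 ^ a)⁻¹ * 2 ^ (a * (T - c p)) := by positivity
      linarith
    -- The truncated subtraction is exact here because `c p < T`.
    · have h2 : T - c p = (T - (c p + 1)) + 1 := by have := hc p; omega
      simp only [mul_zero, add_zero]
      rw [h2, mul_add, pow_add, mul_one]
      apply le_of_eq
      field_simp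
  calc _ ≤ 𝔼 r : (Fin n → Fin L) × (Fin k → Fin n → Fin L), ((2 ^ a)⁻¹ * Φ +
        2 * Φ * 𝔼 x : Fin L × Fin L,
          if tab (callPicks T a c r.1 r.2) (slotExample T a c x) = true then (1 : ℝ) else 0) :=
        expect_le_expect fun r _ => hstep r
    _ = (2 ^ a)⁻¹ * Φ + 2 * Φ * 𝔼 r : (Fin n → Fin L) × (Fin k → Fin n → Fin L),
          𝔼 x : Fin L × Fin L,
          if tab (callPicks T a c r.1 r.2) (slotExample T a c x) = true then (1 : ℝ) else 0 := by
        rw [expect_add_distrib, Fintype.expect_const, ← mul_expect]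
    _ ≤ (2 ^ a)⁻¹ * Φ + 2 * Φ * γ := by
        gcongr
        set F : (Fin n → Fin L) → (Fin k → Fin n → Fin L) → ℝ := fun α g =>
          𝔼 x : Fin L × Fin L,
          if tab (callPicks T a c α g) (slotExample T a c x) = true then (1 : ℝ) else 0 with hF
        set e : Fin k → ℕ := fun i => logWeight T a fun j => c (i, j) with he
        -- Given the center's seeds `α`, the seeds at the slot keys are resampled as `v`. With the
        -- unused seeds `g₀` fixed, the pairs `ω l = (α l, v l)` are independent and uniform,
        -- although the keys depend on `α`.
        have h1 : 𝔼 r : (Fin n → Fin L) × (Fin k → Fin n → Fin L), F r.1 r.2 =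
            𝔼 g₀ : Fin k × Fin n → Fin L, 𝔼 ω : Fin n → Fin L × Fin L,
              F (fun l => (ω l).1) (Function.curry
                (Function.extend (slotKey e fun l => (ω l).1) (fun l => (ω l).2) g₀)) := by
          rw [← univ_product_univ, expect_product' univ univ F]
          have h2 : ∀ α, 𝔼 g, F α g = 𝔼 g₀ : Fin k × Fin n → Fin L, 𝔼 v : Fin n → Fin L,
              F α (Function.curry (Function.extend (slotKey e α) v g₀)) := by
            intro α
            rw [← expect_extend (slotKey_injective e α) fun g => F α (Function.curry g)]
            exact Fintype.expect_equiv (Equiv.curry (Fin k) (Fin n) (Fin L)).symm _ _ fun g => rfl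
          simp only [h2]
          rw [expect_comm]
          refine expect_congr rfl fun g₀ _ => ?_
          rw [← expect_product' univ univ fun (α : Fin n → Fin L) (v : Fin n → Fin L) =>
            F α (Function.curry (Function.extend (slotKey e α) v g₀)), univ_product_univ]
          exact (Fintype.expect_equiv
            (Equiv.arrowProdEquivProdArrow (Fin n) (fun _ => Fin L) (fun _ => Fin L))
            _ _ fun z => rfl).symm
        rw [h1]
        calc _ ≤ 𝔼 _g₀ : Fin k × Fin n → Fin L, γ := by
              refine expect_le_expect fun g₀ _ => ?_
              refine expect_error_consistent_le hA (slotExample T a c) hn M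
                (fun ω => tab (callPicks T a c (fun l => (ω l).1) (Function.curry
                (Function.extend (slotKey e fun l => (ω l).1) (fun l => (ω l).2) g₀))))
                (fun ω => htab _) fun ω l => ?_
              obtain ⟨l', hl'⟩ := slotExample_mem_callPicks T a c (fun l => (ω l).1)
                (Function.curry
                  (Function.extend (slotKey e fun l => (ω l).1) (fun l => (ω l).2) g₀)) l
              rw [Function.uncurry_curry, (slotKey_injective e fun l => (ω l).1).extend_apply] at hl'
              have := hcons (callPicks T a c (fun l => (ω l).1)
                (Function.curry
                  (Function.extend (slotKey e fun l => (ω l).1) (fun l => (ω l).2) g₀))) l'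
              rw [hl'] at this
              exact this
          _ = γ := by simp
    _ = _ := by ring

/-- The numbers of correct classifications after `t` calls. -/
noncomputable def callState {n L : ℕ} (tab : (Fin n → Fin k × Fin m) → Fin k × Fin m → Bool)
    (T a : ℕ) (ξ : ℕ → (Fin n → Fin L) × (Fin k → Fin n → Fin L)) : ℕ → Fin k × Fin m → ℕ
  | 0 => fun _ => 0
  | t + 1 => callStep tab T a (callState tab T a ξ t) (ξ t)

theorem callState_le {n L : ℕ} (tab : (Fin n → Fin k × Fin m) → Fin k × Fin m → Bool)
    (T a : ℕ) (ξ : ℕ → (Fin n → Fin L) × (Fin k → Fin n → Fin L)) (t : ℕ) (p : Fin k × Fin m) :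
    callState tab T a ξ t p ≤ t := by
  induction t with
  | zero => simp [callState]
  | succ t ih => simp only [callState, callStep]; split_ifs <;> omega

theorem callState_congr {n L : ℕ} (tab : (Fin n → Fin k × Fin m) → Fin k × Fin m → Bool)
    (T a : ℕ) {ξ ξ' : ℕ → (Fin n → Fin L) × (Fin k → Fin n → Fin L)} (t : ℕ)
    (h : ∀ s < t, ξ s = ξ' s) : callState tab T a ξ t = callState tab T a ξ' t := by
  induction t with
  | zero => rfl
  | succ t ih => simp only [callState]; rw [ih fun s hs => h s (by omega), h t (by omega)]

/-- Extend a finite sequence of seeds to all natural numbers. -/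
noncomputable def extendSeq {R : Type*} [Nonempty R] {T : ℕ} (ξ : Fin T → R) (t : ℕ) : R :=
  if h : t < T then ξ ⟨t, h⟩ else Classical.arbitrary R

theorem expect_totalWeight_callState_le {T a L d n : ℕ} (hn : 0 < n)
    [Nonempty ((Fin n → Fin L) × (Fin k → Fin n → Fin L))] (hL0 : 0 < L)
    (hL : ∀ W, 0 < W → W ≤ k * m * 2 ^ (a * T) → W ∣ L)
    (tab : (Fin n → Fin k × Fin m) → Fin k × Fin m → Bool) {A : Set (Fin k × Fin m → Bool)}
    (hA : ∀ s : Finset (Fin k × Fin m), Shatters A s → s.card ≤ d) (htab : ∀ J, tab J ∈ A)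
    (hcons : ∀ J l, tab J (J l) = false) (M : ℕ) (t : ℕ) (ht : t ≤ T) :
    𝔼 ξ : Fin T → (Fin n → Fin L) × (Fin k → Fin n → Fin L),
        (totalWeight T a (callState tab T a (extendSeq ξ) t) : ℝ) ≤
      ((2 ^ a)⁻¹ + 2 * (M / n + (∑ i ∈ range (d + 1), (2 * n).choose i : ℕ) / 2 ^ M)) ^ t *
        (k * m * 2 ^ (a * T)) := by
  set ρ : ℝ := (2 ^ a)⁻¹ + 2 * (M / n + (∑ i ∈ range (d + 1), (2 * n).choose i : ℕ) / 2 ^ M)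
    with hρ
  have hρ0 : 0 ≤ ρ := by positivity
  induction t with
  | zero => simp [callState, totalWeight]
  | succ t ih =>
    have hlt : t < T := ht
    have he : Function.Injective (fun _ : Unit => (⟨t, hlt⟩ : Fin T)) := fun _ _ _ => rfl
    -- The seeds of call `t` are averaged first; the state before that call does not depend on them.
    rw [expect_extend he]
    have key : ∀ ξ : Fin T → (Fin n → Fin L) × (Fin k → Fin n → Fin L),
        𝔼 v : Unit → (Fin n → Fin L) × (Fin k → Fin n → Fin L),
          (totalWeight T a (callState tab T a
            (extendSeq (Function.extend (fun _ : Unit => (⟨t, hlt⟩ : Fin T)) v ξ)) (t + 1)) : ℝ) ≤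
        ρ * totalWeight T a (callState tab T a (extendSeq ξ) t) := by
      intro ξ
      refine le_trans (le_of_eq ?_) (expect_totalWeight_callStep_le hL0 hn hL tab hA htab hcons M
        (callState tab T a (extendSeq ξ) t) fun p => (callState_le _ _ _ _ _ _).trans_lt hlt)
      refine Fintype.expect_equiv (Equiv.funUnique Unit _) _ _ fun v => ?_
      have h1 : extendSeq (Function.extend (fun _ : Unit => (⟨t, hlt⟩ : Fin T)) v ξ) t = v () := by
        rw [extendSeq, dif_pos hlt]; exact he.extend_apply v ξ ()
      have h2 : callState tab T a
          (extendSeq (Function.extend (fun _ : Unit => (⟨t, hlt⟩ : Fin T)) v ξ)) t =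
          callState tab T a (extendSeq ξ) t := by
        refine callState_congr _ _ _ _ fun s hs => ?_
        rw [extendSeq, extendSeq, dif_pos (hs.trans hlt), dif_pos (hs.trans hlt)]
        refine Function.extend_apply' _ _ _ ?_
        rintro ⟨-, h⟩
        exact hs.ne' (congrArg Fin.val h)
      simp only [callState]
      rw [h1, h2]
      rfl
    calc _ ≤ 𝔼 ξ : Fin T → (Fin n → Fin L) × (Fin k → Fin n → Fin L),
          ρ * totalWeight T a (callState tab T a (extendSeq ξ) t) :=
          expect_le_expect fun ξ _ => key ξ
      _ = ρ * 𝔼 ξ : Fin T → (Fin n → Fin L) × (Fin k → Fin n → Fin L),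
          (totalWeight T a (callState tab T a (extendSeq ξ) t) : ℝ) := by rw [mul_expect]
      _ ≤ ρ * (ρ ^ t * (k * m * 2 ^ (a * T))) := by gcongr; exact ih (by omega)
      _ = _ := by ring

/-- In expectation few examples are classified correctly by at most half of the `2 τ`
hypotheses. -/
theorem expect_card_half_wrong_le {τ a L d n : ℕ} (hn : 0 < n)
    [Nonempty ((Fin n → Fin L) × (Fin k → Fin n → Fin L))] (hL0 : 0 < L)
    (hL : ∀ W, 0 < W → W ≤ k * m * 2 ^ (a * (2 * τ)) → W ∣ L)
    (tab : (Fin n → Fin k × Fin m) → Fin k × Fin m → Bool) {A : Set (Fin k × Fin m → Bool)}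
    (hA : ∀ s : Finset (Fin k × Fin m), Shatters A s → s.card ≤ d) (htab : ∀ J, tab J ∈ A)
    (hcons : ∀ J l, tab J (J l) = false) (M : ℕ)
    (hM : M / n + (∑ i ∈ range (d + 1), (2 * n).choose i : ℕ) / 2 ^ M ≤ ((2 : ℝ) ^ (a + 1))⁻¹) :
    𝔼 ξ : Fin (2 * τ) → (Fin n → Fin L) × (Fin k → Fin n → Fin L),
        ((univ.filter fun p => callState tab (2 * τ) a (extendSeq ξ) (2 * τ) p ≤ τ).card : ℝ) ≤
      (4 / 2 ^ a) ^ τ * (k * m) := by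
  have h0 := expect_totalWeight_callState_le hn hL0 hL tab hA htab hcons M (2 * τ) le_rfl
  -- The assumption `hM` makes the error contribution to the rate no larger than `2^(-a)`, the
  -- contribution of the correct examples.
  have hρ : (2 ^ a)⁻¹ + 2 * (M / n + (∑ i ∈ range (d + 1), (2 * n).choose i : ℕ) / 2 ^ M) ≤
      2 / (2 : ℝ) ^ a := by
    have : ((2 : ℝ) ^ (a + 1))⁻¹ = (2 ^ a)⁻¹ / 2 := by rw [pow_succ]; field_simp
    rw [this] at hM
    rw [div_eq_mul_inv (2 : ℝ) (2 ^ a)]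
    generalize (M : ℝ) / n + (∑ i ∈ range (d + 1), (2 * n).choose i : ℕ) / 2 ^ M = z at hM ⊢
    linarith
  -- At most `τ` correct answers out of `2τ` leave weight at least `2^(aτ)`. Dividing the bound
  -- `(2/2^a)^(2τ) * k m 2^(2aτ)` on the total by this yields `(4/2^a)^τ * k m`.
  have h1 : ∀ c : Fin k × Fin m → ℕ, ((univ.filter fun p => c p ≤ τ).card : ℝ) * 2 ^ (a * τ) ≤
      totalWeight (2 * τ) a c := by
    intro c
    have : (univ.filter fun p => c p ≤ τ).card * 2 ^ (a * τ) ≤ totalWeight (2 * τ) a c := by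
      rw [totalWeight, ← smul_eq_mul, ← sum_const]
      refine (sum_le_sum fun p hp => ?_).trans (sum_le_sum_of_subset (filter_subset _ _))
      refine Nat.pow_le_pow_right (by norm_num) (Nat.mul_le_mul_left _ ?_)
      have := (mem_filter.1 hp).2
      omega
    exact_mod_cast this
  have hpos : (0 : ℝ) < 2 ^ (a * τ) := by positivity
  refine le_of_mul_le_mul_right ?_ hpos
  rw [expect_mul]
  calc _ ≤ _ := expect_le_expect fun ξ _ => h1 _
    _ ≤ _ := h0
    _ ≤ (2 / (2 : ℝ) ^ a) ^ (2 * τ) * (k * m * 2 ^ (a * (2 * τ))) := by gcongr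
    _ = _ := by
      rw [div_pow, div_pow, pow_mul, pow_mul, ← pow_mul 2 a τ]
      have : (2 : ℝ) ^ (a * (2 * τ)) = 2 ^ (a * τ) * 2 ^ (a * τ) := by rw [← pow_add]; congr 1; ring
      rw [this]
      have h4 : ((2 : ℝ) ^ a) ^ 2 = 2 ^ a * 2 ^ a := by ring
      rw [h4, mul_pow, ← pow_mul 2 a τ]
      norm_num
      field_simp

end BoostProcess

end DistLearn

namespace DistLearn

open Finset BigOperators

/-! ### Concentration of the number of errors on fresh sample points. -/

theorem lintegral_pi_prod {ι X : Type*} [Fintype ι] [MeasurableSpace X] (D : ι → Measure X)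
    [∀ i, IsProbabilityMeasure (D i)] (F : ι → X → ℝ≥0∞) (hF : ∀ i, Measurable (F i)) :
    ∫⁻ y, ∏ i, F i (y i) ∂(Measure.pi D) = ∏ i, ∫⁻ x, F i x ∂(D i) := by
  have hind : ProbabilityTheory.iIndepFun (fun i (y : ι → X) => F i (y i)) (Measure.pi D) :=
    ProbabilityTheory.iIndepFun_pi fun i => (hF i).aemeasurable
  have h := ProbabilityTheory.lintegral_prod_eq_prod_lintegral_of_indepFun univ
    (fun i (y : ι → X) => F i (y i)) hind fun i => (hF i).comp (measurable_pi_apply i)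
  rw [h]
  refine prod_congr rfl fun i _ => ?_
  exact (measurePreserving_eval D i).lintegral_comp (hF i)

/-- The integrand is the exponential of minus the indicator of `E`. Since `e^(-1) ≤ 1/2`, its mean
is at most `1 - D(E)/2`. -/
theorem lintegral_exp_error_le {X : Type*} [MeasurableSpace X] (D : Measure X)
    [IsProbabilityMeasure D] {E : Set X} (hE : MeasurableSet E) :
    ∫⁻ x, E.indicator (fun _ => ENNReal.ofReal (Real.exp (-1))) x +
      Eᶜ.indicator (fun _ => 1) x ∂D ≤ ENNReal.ofReal (Real.exp (-(D.real E) / 2)) := by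
  rw [lintegral_add_left (measurable_const.indicator hE), lintegral_indicator_const hE,
    lintegral_indicator_const hE.compl, one_mul, ← ofReal_measureReal, ← ofReal_measureReal,
    probReal_compl_eq_one_sub hE, ← ENNReal.ofReal_mul (Real.exp_pos _).le,
    ← ENNReal.ofReal_add (by positivity) (by simp)]
  refine ENNReal.ofReal_le_ofReal ?_
  have h1 : Real.exp (-1) ≤ 1 / 2 := by
    rw [Real.exp_neg, one_div]
    exact inv_anti₀ (by norm_num) (by linarith [Real.add_one_le_exp (1 : ℝ)])
  have h2 := Real.add_one_le_exp (-(D.real E) / 2)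
  have h3 : 0 ≤ D.real E := measureReal_nonneg
  nlinarith

open scoped Classical in
/-- If an error set is determined by the coordinates satisfying `p`, it is unlikely that few of the
other, independent, coordinates fall into it although it is large. -/
theorem measure_few_errors_le {ι X : Type*} [Fintype ι] [MeasurableSpace X] (D : ι → Measure X)
    [∀ i, IsProbabilityMeasure (D i)] (p : ι → Prop) [DecidablePred p]
    (E : Set (({i // p i} → X) × X))
    (hE : MeasurableSet E) (K K' : ℝ) :
    Measure.pi D {S | ((univ.filter fun i : {i // ¬ p i} =>
        ((fun j : {i // p i} => S j), S i) ∈ E).card : ℝ) ≤ K ∧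
      K' ≤ ∑ i : {i // ¬ p i}, (D i).real {x | ((fun j : {i // p i} => S j), x) ∈ E}} ≤
      ENNReal.ofReal (Real.exp (K - K' / 2)) := by
  set c : ℝ≥0∞ := ENNReal.ofReal (Real.exp (-1)) with hc
  have hsec : ∀ s : {i // p i} → X, MeasurableSet {x | (s, x) ∈ E} := fun s =>
    measurable_prodMk_left hE
  let φ : ({i // p i} → X) → X → ℝ≥0∞ := fun s x =>
    {x | (s, x) ∈ E}.indicator (fun _ => c) x + {x | (s, x) ∈ E}ᶜ.indicator (fun _ => 1) x
  have hφ : Measurable fun q : ({i // p i} → X) × X => φ q.1 q.2 := by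
    have : (fun q : ({i // p i} → X) × X => φ q.1 q.2) =
        fun q => E.indicator (fun _ => c) q + Eᶜ.indicator (fun _ => 1) q := by
      funext q; simp only [φ, Set.indicator, Set.mem_ofPred_eq, Set.mem_compl_iff]
    rw [this]
    exact (measurable_const.indicator hE).add (measurable_const.indicator hE.compl)
  let Big : Set ({i // p i} → X) :=
    {s | K' ≤ ∑ i : {i // ¬ p i}, (D i).real {x | (s, x) ∈ E}}
  have hBig : MeasurableSet Big := by
    refine measurableSet_le measurable_const (Finset.measurable_sum _ fun i _ => ?_)
    exact (measurable_measure_prodMk_left hE).ennreal_toReal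
  -- On `Big`, this is `exp(-number of errors)`. Given the coordinates in `p`, the error set is
  -- fixed and the others are independent, so the mean factorizes and is at most `exp(-K'/2)`.
  -- Markov's inequality at level `exp(-K)` finishes.
  let Ψ : ({i // p i} → X) × ({i // ¬ p i} → X) → ℝ≥0∞ := fun q =>
    Big.indicator (fun _ => 1) q.1 * ∏ i, φ q.1 (q.2 i)
  have hΨ : Measurable Ψ := by
    refine ((measurable_const.indicator hBig).comp measurable_fst).mul ?_
    refine Finset.measurable_fun_prod _ fun i _ => ?_
    exact hφ.comp (measurable_fst.prodMk ((measurable_pi_apply i).comp measurable_snd))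
  have hmp := measurePreserving_piEquivPiSubtypeProd D p
  have hint : ∫⁻ S, Ψ (MeasurableEquiv.piEquivPiSubtypeProd (fun _ => X) p S) ∂(Measure.pi D) ≤
      ENNReal.ofReal (Real.exp (-K' / 2)) := by
    rw [hmp.lintegral_comp hΨ, lintegral_prod _ hΨ.aemeasurable]
    calc _ ≤ ∫⁻ _s : {i // p i} → X, ENNReal.ofReal (Real.exp (-K' / 2))
          ∂(Measure.pi fun i : {i // p i} => D i) := by
          refine lintegral_mono fun s => ?_
          have hφs : ∀ _i : {i // ¬ p i}, Measurable (φ s) := fun _ =>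
            hφ.comp measurable_prodMk_left
          have hm : Measurable fun y : {i // ¬ p i} → X => ∏ i, φ s (y i) :=
            Finset.measurable_fun_prod _ fun i _ => (hφs i).comp (measurable_pi_apply i)
          simp only [Ψ]
          rw [lintegral_const_mul _ hm,
            lintegral_pi_prod (fun i : {i // ¬ p i} => D i) (fun _ => φ s) hφs]
          by_cases hs : s ∈ Big
          · rw [Set.indicator_of_mem hs, one_mul]
            calc _ ≤ ∏ i : {i // ¬ p i},
                  ENNReal.ofReal (Real.exp (-((D i).real {x | (s, x) ∈ E}) / 2)) :=
                  prod_le_prod' fun i _ => lintegral_exp_error_le (D i) (hsec s)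
              _ ≤ _ := by
                  rw [← ENNReal.ofReal_prod_of_nonneg fun i _ => (Real.exp_pos _).le,
                    ← Real.exp_sum]
                  refine ENNReal.ofReal_le_ofReal (Real.exp_le_exp.2 ?_)
                  have : K' ≤ ∑ i : {i // ¬ p i}, (D i).real {x | (s, x) ∈ E} := hs
                  rw [← sum_div, sum_neg_distrib]
                  linarith
          · rw [Set.indicator_of_notMem hs, zero_mul]; exact zero_le
      _ = _ := by simp
  have hΨm : Measurable fun S => Ψ (MeasurableEquiv.piEquivPiSubtypeProd (fun _ => X) p S) :=
    hΨ.comp (MeasurableEquiv.measurable _)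
  have hmk := meas_ge_le_lintegral_div hΨm.aemeasurable (μ := Measure.pi D)
    (ε := ENNReal.ofReal (Real.exp (-K))) (by simp [Real.exp_pos]) (by simp)
  refine (measure_mono ?_).trans (hmk.trans ?_)
  · rintro S ⟨h1, h2⟩
    have hb : (fun j : {i // p i} => S j) ∈ Big := h2
    have h3 : Ψ (MeasurableEquiv.piEquivPiSubtypeProd (fun _ => X) p S) =
        ENNReal.ofReal (Real.exp (-((univ.filter fun i : {i // ¬ p i} =>
        ((fun j : {i // p i} => S j), S i) ∈ E).card : ℝ))) := by
      change Big.indicator (fun _ => 1) (fun j : {i // p i} => S j) *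
        ∏ i : {i // ¬ p i}, φ (fun j : {i // p i} => S j) (S i) = _
      rw [Set.indicator_of_mem hb, one_mul]
      have h4 : ∀ i : {i // ¬ p i}, φ (fun j : {i // p i} => S j) (S i) =
          if ((fun j : {i // p i} => S j), S i) ∈ E then c else 1 := by
        intro i
        by_cases hi : ((fun j : {i // p i} => S j), S i) ∈ E <;> simp [φ, hi]
      simp only [h4]
      rw [prod_ite, prod_const, prod_const_one, mul_one, hc,
        ← ENNReal.ofReal_pow (Real.exp_pos _).le, ← Real.exp_nat_mul]
      simp
    rw [Set.mem_ofPred_eq, h3]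
    exact ENNReal.ofReal_le_ofReal (Real.exp_le_exp.2 (by linarith))
  · calc _ ≤ ENNReal.ofReal (Real.exp (-K' / 2)) / ENNReal.ofReal (Real.exp (-K)) := by gcongr
      _ = _ := by
        rw [← ENNReal.ofReal_div_of_pos (Real.exp_pos _), ← Real.exp_sub]
        congr 2; ring

/-- The law of the players' samples, with all positions listed in one family. -/
theorem pi_pi_eq_map_curry {k m : ℕ} {X : Type*} [MeasurableSpace X] (D : Fin k → Measure X)
    [∀ i, IsProbabilityMeasure (D i)] :
    (Measure.pi fun i : Fin k => Measure.pi fun _ : Fin m => D i) =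
      (Measure.pi fun q : Fin k × Fin m => D q.1).map (MeasurableEquiv.curry (Fin k) (Fin m) X) := by
  have h := Measure.infinitePi_map_curry fun (i : Fin k) (_ : Fin m) => D i
  simp only [Measure.infinitePi_eq_pi] at h
  exact h.symm

/-! ## Votes of hypotheses fitted to parts of a sample -/

section Vote

variable {X ι : Type*} {n T : ℕ}

/-- The hypothesis that the rule `A` fits to the examples at the positions `J`. -/
def fitAt (A : (Fin n → X × Bool) → X → Bool) (f : X → Bool) (x : ι → X) (J : Fin n → ι) :
    X → Bool :=
  A fun l => (x (J l), f (x (J l)))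

/-- The majority vote of the hypotheses fitted at the positions `J t`. -/
def voteAt (A : (Fin n → X × Bool) → X → Bool) (f : X → Bool) (x : ι → X)
    (J : Fin T → Fin n → ι) (z : X) : Bool :=
  decide (T < 2 * ∑ t, (fitAt A f x (J t) z).toNat)

theorem measurable_fitAt [MeasurableSpace X] {A : (Fin n → X × Bool) → X → Bool}
    (hA : Measurable fun p : (Fin n → X × Bool) × X => A p.1 p.2) {f : X → Bool}
    (hf : Measurable f) (J : Fin n → ι) :
    Measurable fun p : (ι → X) × X => fitAt A f p.1 J p.2 := by
  have h : Measurable fun p : (ι → X) × X =>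
      ((fun l => (p.1 (J l), f (p.1 (J l))) : Fin n → X × Bool), p.2) := by fun_prop
  exact hA.comp h

theorem measurable_voteAt [MeasurableSpace X] {A : (Fin n → X × Bool) → X → Bool}
    (hA : Measurable fun p : (Fin n → X × Bool) × X => A p.1 p.2) {f : X → Bool}
    (hf : Measurable f) (J : Fin T → Fin n → ι) :
    Measurable fun p : (ι → X) × X => voteAt A f p.1 J p.2 := by
  have h1 : Measurable fun p : (ι → X) × X => ∑ t, (fitAt A f p.1 (J t) p.2).toNat :=
    Finset.measurable_sum _ fun t _ => 
      (measurable_from_top (f := Bool.toNat)).comp (measurable_fitAt hA hf (J t))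
  exact (measurable_from_top (f := fun s : ℕ => decide (T < 2 * s))).comp h1

open scoped Classical in
/-- It is unlikely that a vote fitted to few positions has a small error on the sample and a large
error over the mixture. -/
theorem measure_overfit_le {k m : ℕ} [MeasurableSpace X] (D : Fin k → Measure X)
    [∀ i, IsProbabilityMeasure (D i)] {A : (Fin n → X × Bool) → X → Bool}
    (hA : Measurable fun p : (Fin n → X × Bool) × X => A p.1 p.2) {f : X → Bool}
    (hf : Measurable f) (hk : 0 < k) (hm : 2 * (n * T) ≤ m) {ε : ℝ} (hε : 0 ≤ ε) :
    (Measure.pi fun i : Fin k => Measure.pi fun _ : Fin m => D i)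
      {S | ∃ J : Fin T → Fin n → Fin k × Fin m,
        ((univ.filter fun q : Fin k × Fin m =>
          voteAt A f (Function.uncurry S) J (S q.1 q.2) ≠ f (S q.1 q.2)).card : ℝ) ≤
            ε / 8 * (k * m) ∧
        ENNReal.ofReal ε <
          Protocol.mixture D {z | voteAt A f (Function.uncurry S) J z ≠ f z}} ≤
      ENNReal.ofReal ((k * m) ^ (T * n) * Real.exp (-(ε / 8 * (k * m)))) := by
  have hk' : (0 : ℝ) < k := by exact_mod_cast hk
  rw [pi_pi_eq_map_curry, MeasurableEquiv.map_apply]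
  let Bad : (Fin T → Fin n → Fin k × Fin m) → Set (Fin k × Fin m → X) := fun J =>
    {x | ((univ.filter fun q => voteAt A f x J (x q) ≠ f (x q)).card : ℝ) ≤ ε / 8 * (k * m) ∧
      ENNReal.ofReal ε < Protocol.mixture D {z | voteAt A f x J z ≠ f z}}
  have hBad : ∀ J, (Measure.pi fun q : Fin k × Fin m => D q.1) (Bad J) ≤
      ENNReal.ofReal (Real.exp (-(ε / 8 * (k * m)))) := by
    intro J
    -- For fixed `J` the vote only sees the positions in `p`; the remaining ones test it
    -- independently.
    let p : Fin k × Fin m → Prop := fun q => ∃ t l, J t l = q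
    let J' : Fin T → Fin n → {q // p q} := fun t l => ⟨J t l, t, l, rfl⟩
    let E : Set (({q // p q} → X) × X) := {r | voteAt A f r.1 J' r.2 ≠ f r.2}
    have hE : MeasurableSet E :=
      (measurableSet_eq_fun (measurable_voteAt hA hf J') (hf.comp measurable_snd)).compl
    -- At most `ε/8 * km` errors are seen where at least `ε/2 * km` are expected, and `1/8 - (1/2)/2
    -- = -1/8`.
    refine (measure_mono ?_).trans ((measure_few_errors_le (fun q : Fin k × Fin m => D q.1) p E hE
      (ε / 8 * (k * m)) (ε / 2 * (k * m))).trans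
        (ENNReal.ofReal_le_ofReal (Real.exp_le_exp.2 (by linarith))))
    rintro x ⟨h1, h2⟩
    refine ⟨le_trans (Nat.cast_le.2 ?_) h1, ?_⟩
    · refine card_le_card_of_injOn (fun i => i.1) (fun i hi => ?_) (fun i _ j _ h => Subtype.ext h)
      simp only [coe_filter, mem_univ, true_and, Set.mem_ofPred_eq] at hi ⊢
      exact hi
    · set r : Fin k → ℝ := fun i => (D i).real {z | voteAt A f x J z ≠ f z} with hr
      have hr0 : ∀ i, 0 ≤ r i := fun i => measureReal_nonneg
      have hsum : ε * k ≤ ∑ i, r i := by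
        have h3 : Protocol.mixture D {z | voteAt A f x J z ≠ f z} =
            ENNReal.ofReal ((∑ i, r i) / k) := by
          rw [Protocol.mixture, Measure.smul_apply, Measure.finsetSum_apply, smul_eq_mul,
            div_eq_inv_mul, ENNReal.ofReal_mul (by positivity), ENNReal.ofReal_inv_of_pos hk',
            ENNReal.ofReal_natCast, ENNReal.ofReal_sum_of_nonneg fun i _ => hr0 i]
          simp [hr]
        rw [h3] at h2
        have := (ENNReal.ofReal_lt_ofReal_iff_of_nonneg hε).1 h2
        rw [lt_div_iff₀ hk'] at this
        exact this.le
      -- No player has more than `nT ≤ m/2` used positions. So every player keeps half of its sample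
      -- as test points, and the mixture stays balanced.
      have hused : ∀ i, (m : ℝ) / 2 ≤ (univ.filter fun j : Fin m => ¬ p (i, j)).card := by
        intro i
        have h4 : (univ.filter fun j : Fin m => p (i, j)).card ≤ T * n := by
          calc _ ≤ (univ.image fun tl : Fin T × Fin n => (J tl.1 tl.2).2).card := by
                refine card_le_card fun j hj => ?_
                obtain ⟨t, l, h⟩ := (mem_filter.1 hj).2
                exact mem_image.2 ⟨(t, l), mem_univ _, by rw [h]⟩
            _ ≤ _ := card_image_le.trans (by simp)
        have h5 := card_filter_add_card_filter_not (s := univ) fun j : Fin m => p (i, j)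
        rw [card_univ, Fintype.card_fin] at h5
        have h6 : m ≤ 2 * (univ.filter fun j : Fin m => ¬ p (i, j)).card := by
          rw [mul_comm] at h4; omega
        have : (m : ℝ) ≤ 2 * (univ.filter fun j : Fin m => ¬ p (i, j)).card := by exact_mod_cast h6
        linarith
      have h7 : ∑ i : {q // ¬ p q}, (D i.1.1).real {z | ((fun j : {q // p q} => x j), z) ∈ E} =
          ∑ i, (univ.filter fun j : Fin m => ¬ p (i, j)).card * r i := by
        calc _ = ∑ q : {q // ¬ p q}, r q.1.1 := rfl
          _ = ∑ q ∈ univ.filter (fun q => ¬ p q), r q.1 :=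
            (sum_subtype (p := fun q => ¬ p q) _ (by simp) fun q => r q.1).symm
          _ = ∑ i, ∑ j, if ¬ p (i, j) then r i else 0 := by
            rw [sum_filter, ← univ_product_univ, sum_product]
          _ = _ := by
            refine sum_congr rfl fun i _ => ?_
            rw [← sum_filter, sum_const, nsmul_eq_mul]
      rw [h7]
      calc ε / 2 * (k * m) = m / 2 * (ε * k) := by ring
        _ ≤ m / 2 * ∑ i, r i := by gcongr
        _ = ∑ i, m / 2 * r i := by rw [mul_sum]
        _ ≤ _ := sum_le_sum fun i _ => mul_le_mul_of_nonneg_right (hused i) (hr0 i)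
  -- The positions are chosen depending on the data, hence the union over all `(km)^(Tn)` choices.
  calc _ ≤ (Measure.pi fun q : Fin k × Fin m => D q.1) (⋃ J, Bad J) := by
        refine measure_mono ?_
        rintro x ⟨J, hJ⟩
        exact Set.mem_iUnion.2 ⟨J, hJ⟩
    _ ≤ ∑ J, (Measure.pi fun q : Fin k × Fin m => D q.1) (Bad J) := measure_iUnion_fintype_le _ _
    _ ≤ ∑ _J : Fin T → Fin n → Fin k × Fin m, ENNReal.ofReal (Real.exp (-(ε / 8 * (k * m)))) :=
        sum_le_sum fun J _ => hBad J
    _ = _ := by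
        rw [sum_const, nsmul_eq_mul, ENNReal.ofReal_mul (by positivity), card_univ]
        congr 1
        rw [← ENNReal.ofReal_natCast]
        congr 1
        simp [← pow_mul, mul_comm]

end Vote

end DistLearn

namespace DistLearn

open Finset BigOperators

/-! ## The boosting protocol -/

/-- Encodings of the center's and the players' messages by bits. -/
structure MessageCode (k n a : ℕ) where
  centerBits : ℕ
  playerBits : ℕ
  encodeCounts : (Fin k → Fin (n + 1)) → Fin centerBits → Bool
  decodeCounts : (Fin centerBits → Bool) → Fin k → Fin (n + 1)
  encodeDrop : ℕ → Fin playerBits → Bool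
  decodeDrop : (Fin playerBits → Bool) → ℕ
  decode_counts : ∀ v, decodeCounts (encodeCounts v) = v
  decode_drop : ∀ s ≤ a, decodeDrop (encodeDrop s) = s

theorem exists_messageCode (k n a b b' : ℕ) (hb : n + 1 ≤ 2 ^ b) (hb' : a + 1 ≤ 2 ^ b') :
    ∃ K : MessageCode k n a, K.centerBits = k * b ∧ K.playerBits = b' := by
  have h1 : Nonempty ((Fin k → Fin (n + 1)) ↪ (Fin (k * b) → Bool)) :=
    Function.Embedding.nonempty_of_card_le (by
      simp only [Fintype.card_pi, Fintype.card_fin, prod_const, card_univ, Fintype.card_bool]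
      rw [mul_comm, pow_mul]
      exact Nat.pow_le_pow_left hb k)
  have h2 : Nonempty (Fin (a + 1) ↪ (Fin b' → Bool)) :=
    Function.Embedding.nonempty_of_card_le (by simpa using hb')
  obtain ⟨e⟩ := h1
  obtain ⟨e'⟩ := h2
  refine ⟨⟨k * b, b', e, Function.invFun e, fun s => e' (Fin.ofNat (a + 1) s),
    fun v => (Function.invFun e' v).val, fun v => Function.leftInverse_invFun e.injective v,
    fun s hs => ?_⟩, rfl, rfl⟩
  rw [Function.leftInverse_invFun e'.injective]
  simp only [Fin.val_ofNat]
  exact Nat.mod_eq_of_lt (by omega)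

theorem length_transcript {X : Type u} {k : ℕ} (π : Protocol X k) (f : X → Bool) (ω : π.Outcome)
    (t : ℕ) : (π.transcript f ω t).length = t := by
  induction t with
  | zero => rfl
  | succ t ih => simp only [Protocol.transcript, List.length_cons, ih]

section Boost

variable {X : Type u} {k m n T a L : ℕ} [NeZero k] [NeZero m] [NeZero L]

/-- The examples sent in one round, player by player. -/
def roundExamples {cb pb : ℕ} (r : RoundRecord X k cb pb) : List (X × Bool) :=
  (List.finRange k).flatMap r.examples

open scoped Classical in
/-- The hypothesis fitted to a list of `n` examples. -/
noncomputable def fitList (A : (Fin n → X × Bool) → X → Bool) (l : List (X × Bool)) : X → Bool :=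
  if h : l.length = n then A fun j => l.get (j.cast h.symm) else fun _ => false

/-- The hypotheses that a transcript determines; examples count in rounds of odd number only. -/
noncomputable def transcriptHyps {cb pb : ℕ} (A : (Fin n → X × Bool) → X → Bool) :
    List (RoundRecord X k cb pb) → List (X → Bool)
  | [] => []
  | r :: τ => if τ.length % 2 = 1 then fitList A (roundExamples r) :: transcriptHyps A τ
    else transcriptHyps A τ

/-- The orders of magnitude of the players' weights that a transcript determines; they are updated
in rounds of even number. -/
def transcriptLogs (K : MessageCode k n a) (m T : ℕ) :
    List (RoundRecord X k K.centerBits K.playerBits) → Fin k → ℕ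
  | [] => fun _ => Nat.log 2 (m * 2 ^ (a * T))
  | r :: τ => if τ.length % 2 = 0
    then fun i => transcriptLogs K m T τ i - K.decodeDrop (r.bits i)
    else transcriptLogs K m T τ

/-- How many of the hypotheses are correct on each example of a sample. -/
def correctCount (hs : List (X → Bool)) (s : Fin m → X × Bool) (j : Fin m) : ℕ :=
  hs.countP fun h => h (s j).1 == (s j).2

/-- The uniform law on a finite type of seeds. -/
noncomputable def uniformSeed (Ω : Type) [Fintype Ω] [Nonempty Ω] : @Measure Ω ⊤ :=
  letI : MeasurableSpace Ω := ⊤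
  (PMF.uniformOfFintype Ω).toMeasure

/-- The distributed boosting protocol with `T` calls. Each call takes two rounds: first the players
send the drop of the orders of magnitude of their weights, then the center distributes the `n`
slots and the players fill them with examples drawn according to their weights. -/
noncomputable def boostProtocol (K : MessageCode k n a) (m T L : ℕ) [NeZero m] [NeZero L]
    (A : (Fin n → X × Bool) → X → Bool) : Protocol X k where
  rounds := 2 * T
  sampleSize := m
  centerBits := K.centerBits
  playerBits := K.playerBits
  Seed := Fin T → Fin n → Fin L
  seedSpace := ⊤
  seedLaw := uniformSeed (Fin T → Fin n → Fin L)
  seedLaw_prob := by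
    let _ : MeasurableSpace (Fin T → Fin n → Fin L) := ⊤
    exact PMF.toMeasure.isProbabilityMeasure _
  centerMsg τ ω := K.encodeCounts fun i =>
    ⟨slotCount (transcriptLogs K m T τ) (extendSeq ω (τ.length / 2)) i,
      Nat.lt_succ_of_le (slotCount_le _ _ i)⟩
  -- The number of examples must be bounded for every conceivable message, also for those that the
  -- center never sends; hence the guard on the sum.
  request τ c i := if τ.length % 2 = 1 ∧ ∑ i, (K.decodeCounts c i).val ≤ n
    then (K.decodeCounts c i).val else 0
  pick i τ c s ω := localPicks T a (correctCount (transcriptHyps A τ) s)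
    (extendSeq ω (τ.length / 2))
    (if τ.length % 2 = 1 ∧ ∑ i, (K.decodeCounts c i).val ≤ n then (K.decodeCounts c i).val else 0)
  length_pick i τ c s ω := length_localPicks _ _ _ _ (by
    split_ifs
    · exact Nat.le_of_lt_succ (K.decodeCounts c i).isLt
    · exact Nat.zero_le _)
  playerMsg i τ _ s _ := K.encodeDrop
    (transcriptLogs K m T τ i - logWeight T a (correctCount (transcriptHyps A τ) s))
  output τ := fun x => decide (T < 2 * ((transcriptHyps A τ).map fun h => (h x).toNat).sum)

theorem boostProtocol_request_le (K : MessageCode k n a) (A : (Fin n → X × Bool) → X → Bool)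
    (τ : List (RoundRecord X k K.centerBits K.playerBits)) (c : Fin K.centerBits → Bool) :
    ∑ i, (boostProtocol K m T L A).request τ c i ≤ n := by
  change ∑ i, (if τ.length % 2 = 1 ∧ ∑ i, (K.decodeCounts c i).val ≤ n
    then (K.decodeCounts c i).val else 0) ≤ n
  split_ifs with h
  · exact h.2
  · simp

/-- The error bits, on the sample `x`, of the hypotheses fitted to parts of it. -/
def errorTable {ι : Type*} (A : (Fin n → X × Bool) → X → Bool) (f : X → Bool) (x : ι → X)
    (J : Fin n → ι) (q : ι) : Bool :=
  fitAt A f x J (x q) != f (x q)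

/-- The seeds of all parties, call by call. -/
def seedsByCall (ω : (Fin T → Fin n → Fin L) × (Fin k → Fin T → Fin n → Fin L)) (t : Fin T) :
    (Fin n → Fin L) × (Fin k → Fin n → Fin L) :=
  (ω.1 t, fun i => ω.2 i t)

theorem extendSeq_seedsByCall (ω : (Fin T → Fin n → Fin L) × (Fin k → Fin T → Fin n → Fin L))
    {t : ℕ} (ht : t < T) :
    extendSeq (seedsByCall ω) t = (extendSeq ω.1 t, fun i => extendSeq (ω.2 i) t) := by
  simp only [extendSeq, dif_pos ht, seedsByCall]

theorem logWeight_zero :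
    logWeight T a (fun _ : Fin m => 0) = Nat.log 2 (m * 2 ^ (a * T)) := by
  simp [logWeight, localWeight]

theorem logWeight_le_of_le {c c' : Fin m → ℕ} (h : ∀ j, c j ≤ c' j) :
    logWeight T a c' ≤ logWeight T a c :=
  Nat.log_mono_right <| sum_le_sum fun j _ => Nat.pow_le_pow_right (by norm_num)
    (Nat.mul_le_mul_left _ (by have := h j; omega))

/-- One more correct answer divides a weight by at most `2^a`. The drop that a player announces
therefore takes only the values `0, …, a`. -/
theorem logWeight_le_add {c c' : Fin m → ℕ} (h : ∀ j, c' j ≤ c j + 1) :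
    logWeight T a c ≤ logWeight T a c' + a := by
  have h1 : ∑ j, localWeight T a c j ≤ (∑ j, localWeight T a c' j) * 2 ^ a := by
    rw [sum_mul]
    refine sum_le_sum fun j _ => ?_
    rw [localWeight, localWeight, ← pow_add]
    refine Nat.pow_le_pow_right (by norm_num) ?_
    calc a * (T - c j) ≤ a * ((T - c' j) + 1) := Nat.mul_le_mul_left _ (by have := h j; omega)
      _ = _ := by ring
  have h2 := Nat.log_mono_right (b := 2) h1
  have h3 : ∀ (a N : ℕ), 0 < N → Nat.log 2 (N * 2 ^ a) = Nat.log 2 N + a := by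
    intro a N hN
    induction a with
    | zero => simp
    | succ a ih =>
      rw [pow_succ, ← mul_assoc, Nat.log_mul_base (by norm_num) (by positivity), ih]; ring
  rwa [h3 _ _ (sum_localWeight_pos _ _ _)] at h2

/-! ### Executions of the protocol are runs of the boosting process. -/

section Transcript

variable (K : MessageCode k n a) (A : (Fin n → X × Bool) → X → Bool) (f : X → Bool)
  (S : Fin k → Fin m → X) (ω : (Fin T → Fin n → Fin L) × (Fin k → Fin T → Fin n → Fin L))

/-- The state of the boosting process in an execution of the protocol. -/
noncomputable def runState (t : ℕ) : Fin k × Fin m → ℕ :=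
  callState (errorTable A f (Function.uncurry S)) T a (extendSeq (seedsByCall ω)) t

/-- The positions of the examples sent in an execution of the protocol. -/
noncomputable def runPicks (t : ℕ) : Fin n → Fin k × Fin m :=
  callPicks T a (runState (a := a) A f S ω t) (extendSeq (seedsByCall ω) t).1
    (extendSeq (seedsByCall ω) t).2

/-- The first `t` hypotheses in an execution of the protocol. -/
noncomputable def runHyps : ℕ → List (X → Bool)
  | 0 => []
  | t + 1 => fitAt A f (Function.uncurry S) (runPicks (a := a) A f S ω t) :: runHyps t

theorem correctCount_runHyps (t : ℕ) (i : Fin k) :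
    correctCount (runHyps (a := a) A f S ω t) (fun j => (S i j, f (S i j))) =
      fun j => runState (a := a) A f S ω t (i, j) := by
  funext j
  induction t with
  | zero => rfl
  | succ t ih =>
    rw [correctCount] at ih ⊢
    rw [runHyps, List.countP_cons, ih]
    simp only [runState, callState, callStep]
    congr 1
    simp only [errorTable, runPicks, runState, Function.uncurry_apply_pair]
    by_cases h : fitAt A f (Function.uncurry S) (callPicks T a (callState
      (errorTable A f (Function.uncurry S)) T a (extendSeq (seedsByCall ω)) t)
      (extendSeq (seedsByCall ω) t).1 (extendSeq (seedsByCall ω) t).2) (S i j) = f (S i j)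
    · simp [h]
    · simp [h]

theorem runState_mono (t : ℕ) (q : Fin k × Fin m) :
    runState (a := a) A f S ω t q ≤ runState (a := a) A f S ω (t + 1) q :=
  Nat.le_add_right _ _

theorem runState_succ_le (t : ℕ) (q : Fin k × Fin m) :
    runState (a := a) A f S ω (t + 1) q ≤ runState (a := a) A f S ω t q + 1 := by
  simp only [runState, callState, callStep]
  split_ifs <;> omega

/-- After `2t` rounds the public weights lag one call behind the hypotheses, since the drop caused
by a call is announced only in the next even round. At `t = 0` the truncated `t - 1` is harmless:
the initial orders are known to everybody. -/
theorem transcript_boostProtocol (t : ℕ) (ht : t ≤ T) :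
    transcriptHyps A ((boostProtocol K m T L A).transcript f (S, ω) (2 * t)) =
        runHyps (a := a) A f S ω t ∧
      transcriptLogs K m T ((boostProtocol K m T L A).transcript f (S, ω) (2 * t)) =
        fun i => logWeight T a fun j => runState (a := a) A f S ω (t - 1) (i, j) := by
  induction t with
  | zero =>
    refine ⟨rfl, ?_⟩
    funext i
    exact logWeight_zero.symm
  | succ t ih =>
    obtain ⟨ih1, ih2⟩ := ih (by omega)
    have hlt : t < T := ht
    set π := boostProtocol K m T L A with hπ
    set τ := π.transcript f (S, ω) (2 * t) with hτ
    have hlen : τ.length = 2 * t := length_transcript _ _ _ _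
    set τ' := π.transcript f (S, ω) (2 * t + 1) with hτ'
    have hlen' : τ'.length = 2 * t + 1 := length_transcript _ _ _ _
    have hmid1 : transcriptHyps A τ' = runHyps (a := a) A f S ω t := by
      rw [hτ', Protocol.transcript, transcriptHyps, if_neg]
      · exact ih1
      · change ¬ τ.length % 2 = 1
        rw [hlen]; omega
    have hmid2 : transcriptLogs K m T τ' =
        fun i => logWeight T a fun j => runState (a := a) A f S ω t (i, j) := by
      have h0 : transcriptLogs K m T τ' = fun i => transcriptLogs K m T τ i -
          K.decodeDrop (K.encodeDrop (transcriptLogs K m T τ i - logWeight T a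
            (correctCount (transcriptHyps A τ) (fun j => (S i j, f (S i j)))))) := by
        rw [hτ', Protocol.transcript]
        change (if τ.length % 2 = 0 then _ else _) = _
        rw [if_pos (by rw [hlen]; omega)]
        rfl
      rw [h0]
      funext i
      rw [ih1, ih2, correctCount_runHyps]
      -- The orders decrease, by at most `a`, so the truncated difference is the true drop and
      -- survives the encoding.
      have h1 : logWeight T a (fun j => runState (a := a) A f S ω t (i, j)) ≤
          logWeight T a (fun j => runState (a := a) A f S ω (t - 1) (i, j)) := by
        refine logWeight_le_of_le fun j => ?_
        cases t with
        | zero => exact le_rfl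
        | succ t => exact runState_mono _ _ _ _ _ _
      have h2 : logWeight T a (fun j => runState (a := a) A f S ω (t - 1) (i, j)) ≤
          logWeight T a (fun j => runState (a := a) A f S ω t (i, j)) + a := by
        refine logWeight_le_add fun j => ?_
        cases t with
        | zero => exact Nat.le_succ _
        | succ t => exact runState_succ_le _ _ _ _ _ _
      beta_reduce
      rw [K.decode_drop _ (by omega)]
      omega
    have hseed := extendSeq_seedsByCall ω hlt
    have hc1 : (π.centerMsg τ' ω.1) = K.encodeCounts fun i =>
        ⟨slotCount (transcriptLogs K m T τ') (extendSeq ω.1 (τ'.length / 2)) i,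
          Nat.lt_succ_of_le (slotCount_le _ _ i)⟩ := rfl
    have hhalf : τ'.length / 2 = t := by rw [hlen']; omega
    have hex : ∀ i, (π.pick i τ' (π.centerMsg τ' ω.1) (π.sample f (S, ω) i) (ω.2 i)).map
        (π.sample f (S, ω) i) =
        (localPicks T a (fun j => runState (a := a) A f S ω t (i, j)) (extendSeq (ω.2 i) t)
          (slotCount (fun i => logWeight T a fun j => runState (a := a) A f S ω t (i, j))
            (extendSeq ω.1 t) i)).map fun j => (S i j, f (S i j)) := by
      intro i
      have hpick : π.pick i τ' (π.centerMsg τ' ω.1) (π.sample f (S, ω) i) (ω.2 i) =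
          localPicks T a (correctCount (transcriptHyps A τ') (fun j => (S i j, f (S i j))))
            (extendSeq (ω.2 i) (τ'.length / 2))
            (if τ'.length % 2 = 1 ∧ ∑ i, (K.decodeCounts (π.centerMsg τ' ω.1) i).val ≤ n
              then (K.decodeCounts (π.centerMsg τ' ω.1) i).val else 0) := rfl
      rw [hpick, hc1, K.decode_counts, hmid1, hmid2, correctCount_runHyps, hhalf, if_pos]
      · rfl
      · refine ⟨by rw [hlen']; omega, le_of_eq ?_⟩
        exact sum_slotCount _ _
    refine ⟨?_, ?_⟩
    · have h0 : transcriptHyps A (π.transcript f (S, ω) (2 * (t + 1))) =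
          fitList A ((List.finRange k).flatMap fun i =>
            (π.pick i τ' (π.centerMsg τ' ω.1) (π.sample f (S, ω) i) (ω.2 i)).map
              (π.sample f (S, ω) i)) :: transcriptHyps A τ' := by
        rw [show 2 * (t + 1) = (2 * t + 1) + 1 by ring, Protocol.transcript]
        change (if τ'.length % 2 = 1 then _ else _) = _
        rw [if_pos (by rw [hlen']; omega)]
        rfl
      rw [h0, hmid1, runHyps]
      congr 1
      simp only [hex]
      have hlist : ((List.finRange k).flatMap fun i =>
          (localPicks T a (fun j => runState (a := a) A f S ω t (i, j)) (extendSeq (ω.2 i) t)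
          (slotCount (fun i => logWeight T a fun j => runState (a := a) A f S ω t (i, j))
            (extendSeq ω.1 t) i)).map fun j => (S i j, f (S i j))) =
          (jointPicks T a (runState (a := a) A f S ω t) (extendSeq ω.1 t)
            (fun i => extendSeq (ω.2 i) t)).map fun q =>
              (Function.uncurry S q, f (Function.uncurry S q)) := by
        rw [jointPicks, List.map_flatMap]
        simp only [List.map_map]
        rfl
      have hl : (((jointPicks T a (runState (a := a) A f S ω t) (extendSeq ω.1 t)
            (fun i => extendSeq (ω.2 i) t)).map fun q =>
              (Function.uncurry S q, f (Function.uncurry S q)))).length = n := by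
        rw [List.length_map, length_jointPicks]
      rw [hlist, fitList, dif_pos hl, fitAt, runPicks, hseed]
      congr 1
      funext l
      simp [callPicks]
    · have h0 : transcriptLogs K m T (π.transcript f (S, ω) (2 * (t + 1))) =
          transcriptLogs K m T τ' := by
        rw [show 2 * (t + 1) = (2 * t + 1) + 1 by ring, Protocol.transcript]
        change (if τ'.length % 2 = 0 then _ else _) = _
        rw [if_neg (by rw [hlen']; omega)]
      rw [h0, hmid2]
      rfl

theorem sum_runHyps (x : X) (t : ℕ) :
    ((runHyps (a := a) A f S ω t).map fun h => (h x).toNat).sum =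
      ∑ s ∈ range t, (fitAt A f (Function.uncurry S) (runPicks (a := a) A f S ω s) x).toNat := by
  induction t with
  | zero => rfl
  | succ t ih => rw [runHyps, List.map_cons, List.sum_cons, ih, sum_range_succ, add_comm]

/-- The protocol outputs a vote of hypotheses fitted to parts of the sample. -/
theorem hypothesis_boostProtocol :
    (boostProtocol K m T L A).hypothesis f (S, ω) =
      voteAt A f (Function.uncurry S) fun t : Fin T => runPicks (a := a) A f S ω t := by
  funext x
  have h := (transcript_boostProtocol K A f S ω T le_rfl).1
  have h0 : (boostProtocol K m T L A).hypothesis f (S, ω) x =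
      decide (T < 2 * ((transcriptHyps A ((boostProtocol K m T L A).transcript f (S, ω)
        (2 * T))).map fun h => (h x).toNat).sum) := rfl
  rw [h0, h, sum_runHyps, voteAt]
  rw [Fin.sum_univ_eq_sum_range (fun s =>
    (fitAt A f (Function.uncurry S) (runPicks (a := a) A f S ω s) x).toNat) T]

theorem sum_errors_add_runState (t : ℕ) (q : Fin k × Fin m) :
    runState (a := a) A f S ω t q + ∑ s ∈ range t,
      (errorTable A f (Function.uncurry S) (runPicks (a := a) A f S ω s) q).toNat = t := by
  induction t with
  | zero => rfl
  | succ t ih =>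
    rw [sum_range_succ]
    have h : runState (a := a) A f S ω (t + 1) q = runState (a := a) A f S ω t q +
        if errorTable A f (Function.uncurry S) (runPicks (a := a) A f S ω t) q then 0 else 1 := rfl
    rw [h]
    cases errorTable A f (Function.uncurry S) (runPicks (a := a) A f S ω t) q <;> simp <;> omega

end Transcript

/-- A vote errs only where at most half of the hypotheses are correct. -/
theorem runState_le_of_vote_ne {τ : ℕ} (A : (Fin n → X × Bool) → X → Bool) (f : X → Bool)
    (S : Fin k → Fin m → X)
    (ω : (Fin (2 * τ) → Fin n → Fin L) × (Fin k → Fin (2 * τ) → Fin n → Fin L))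
    (q : Fin k × Fin m)
    (h : voteAt A f (Function.uncurry S)
      (fun t : Fin (2 * τ) => runPicks (a := a) A f S ω t) (S q.1 q.2) ≠ f (S q.1 q.2)) :
    runState (a := a) A f S ω (2 * τ) q ≤ τ := by
  have h1 := sum_errors_add_runState (a := a) A f S ω (2 * τ) q
  rw [← Fin.sum_univ_eq_sum_range (fun s =>
    (errorTable A f (Function.uncurry S) (runPicks (a := a) A f S ω s) q).toNat) (2 * τ)] at h1
  have hx : Function.uncurry S q = S q.1 q.2 := rfl
  simp only [errorTable, hx] at h1
  unfold voteAt at h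
  cases hf : f (S q.1 q.2) with
  | true =>
    rw [hf] at h
    simp only [hf, Bool.bne_true] at h1
    have h2 : ∀ b : Bool, (!b).toNat + b.toNat = 1 := by decide
    have h3 : ∑ t : Fin (2 * τ), (!fitAt A f (Function.uncurry S)
        (runPicks (a := a) A f S ω t) (S q.1 q.2)).toNat +
        ∑ t : Fin (2 * τ), (fitAt A f (Function.uncurry S)
        (runPicks (a := a) A f S ω t) (S q.1 q.2)).toNat = 2 * τ := by
      rw [← sum_add_distrib]
      simp only [h2]
      simp
    simp only [ne_eq, decide_eq_true_eq, not_lt] at h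
    omega
  | false =>
    rw [hf] at h
    simp only [hf, Bool.bne_false] at h1
    simp only [ne_eq, decide_eq_false_iff_not, not_not] at h
    omega

end Boost

end DistLearn

namespace DistLearn

open Finset BigOperators

/-! ## Analysis of the boosting protocol -/

theorem prod_pi_uniform_apply {Ω : Type*} [Fintype Ω] [Nonempty Ω] [MeasurableSpace Ω]
    [MeasurableSingletonClass Ω] (ν : Measure Ω) [IsProbabilityMeasure ν]
    (hν : ∀ x, ν {x} = (Fintype.card Ω : ℝ≥0∞)⁻¹) (k : ℕ) (s : Finset (Ω × (Fin k → Ω))) :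
    (ν.prod (Measure.pi fun _ : Fin k => ν)) (s : Set (Ω × (Fin k → Ω))) =
      s.card * (Fintype.card (Ω × (Fin k → Ω)) : ℝ≥0∞)⁻¹ := by
  rw [← sum_measure_singleton]
  have h : ∀ x : Ω × (Fin k → Ω), (ν.prod (Measure.pi fun _ : Fin k => ν)) {x} =
      (Fintype.card (Ω × (Fin k → Ω)) : ℝ≥0∞)⁻¹ := by
    rintro ⟨x, y⟩
    rw [← Set.singleton_prod_singleton, Measure.prod_prod, Measure.pi_singleton]
    simp only [hν, prod_const, card_univ, Fintype.card_fin, Fintype.card_prod, Fintype.card_pi]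
    rw [Nat.cast_mul, Nat.cast_pow, ENNReal.mul_inv (by simp) (by simp), ENNReal.inv_pow]
  simp [h]

/-- The failure event need not be measurable. It is covered by `Bad` times everything and by an
event that depends on the data only through a finite table. The latter is measurable, so Fubini
applies to it. -/
theorem measure_outcome_le {Y Tab Ω : Type*} [MeasurableSpace Y] [MeasurableSpace Ω]
    [DiscreteMeasurableSpace Ω] [Finite Ω] [Finite Tab] [MeasurableSpace Tab]
    [DiscreteMeasurableSpace Tab] (μ : Measure Y) [IsProbabilityMeasure μ]
    (ρ : Measure Ω) [IsProbabilityMeasure ρ] (Bad : Set Y)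
    {θ : Y → Tab} (hθ : Measurable θ) (E : Tab → Set Ω) {c₁ c₂ : ℝ≥0∞} (h₁ : μ Bad ≤ c₁)
    (h₂ : ∀ y, ρ (E (θ y)) ≤ c₂) {F : Set (Y × Ω)} (hF : ∀ ω ∈ F, ω.1 ∈ Bad ∨ ω.2 ∈ E (θ ω.1)) :
    (μ.prod ρ) F ≤ c₁ + c₂ := by
  let G : Set (Y × Ω) := {ω | ω.2 ∈ E (θ ω.1)}
  have hG : MeasurableSet G := by
    have h : Measurable fun ω : Y × Ω => (θ ω.1, ω.2) :=
      (hθ.comp measurable_fst).prodMk measurable_snd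
    exact h (Set.Countable.measurableSet (Set.to_countable {p : Tab × Ω | p.2 ∈ E p.1}))
  calc (μ.prod ρ) F ≤ (μ.prod ρ) (Bad ×ˢ Set.univ ∪ G) := by
        refine measure_mono fun ω hω => ?_
        rcases hF ω hω with h | h
        · exact Or.inl ⟨h, trivial⟩
        · exact Or.inr h
    _ ≤ (μ.prod ρ) (Bad ×ˢ Set.univ) + (μ.prod ρ) G := measure_union_le _ _
    _ ≤ c₁ + c₂ := by
        gcongr
        · rw [Measure.prod_prod]; simpa using h₁
        · rw [Measure.prod_apply hG]
          calc _ ≤ ∫⁻ _y, c₂ ∂μ := lintegral_mono fun y => h₂ y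
            _ = c₂ := by simp

/-- Adding a fixed `f` modulo 2 permutes the labellings, so error patterns are no richer than the
class. -/
theorem shatters_errorPatterns_card_le {X : Type u} {ι : Type*} {H : Set (X → Bool)} {d : ℕ}
    (hd : HasVCDim H d) (f : X → Bool) (x : ι → X) (s : Finset ι)
    (hs : Shatters {b : ι → Bool | ∃ h ∈ H, ∀ q, b q = (h (x q) != f (x q))} s) : s.card ≤ d := by
  classical
  have hinj : Set.InjOn x s := by
    intro i hi j hj hij
    by_contra hne
    obtain ⟨b, ⟨h, -, hb⟩, hbs⟩ := hs fun q => decide (q = i)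
    have h1 := hbs i hi
    have h2 := hbs j hj
    rw [hb, hij] at h1
    rw [hb, h1] at h2
    simp [Ne.symm hne] at h2
  have hsh : Shatters H (s.image x) := by
    intro c
    obtain ⟨b, ⟨h, hH, hb⟩, hbs⟩ := hs fun q => c (x q) != f (x q)
    refine ⟨h, hH, fun y hy => ?_⟩
    obtain ⟨q, hq, rfl⟩ := mem_image.1 hy
    have := hbs q hq
    rw [hb] at this
    revert this
    cases h (x q) <;> cases f (x q) <;> cases c (x q) <;> simp
  have := hd.2 ⟨_, rfl, hsh⟩
  rwa [card_image_of_injOn hinj] at this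

section Learn

variable {X : Type u} {k m n a τ L : ℕ} [NeZero k] [NeZero m] [NeZero L]

theorem seedsByCall_bijective {T : ℕ} : Function.Bijective
    (seedsByCall : (Fin T → Fin n → Fin L) × (Fin k → Fin T → Fin n → Fin L) → _) := by
  refine Function.bijective_iff_has_inverse.2
    ⟨fun ξ => (fun t => (ξ t).1, fun i t => (ξ t).2 i), fun _ => rfl, fun _ => rfl⟩

/-- Markov's inequality: the mean fraction of such examples is at most `εδ/16`, the threshold is
`ε/8`. -/
theorem card_bad_seeds_le (hn : 0 < n) {d M : ℕ}
    (hL : ∀ W, 0 < W → W ≤ k * m * 2 ^ (a * (2 * τ)) → W ∣ L)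
    (tab : (Fin n → Fin k × Fin m) → Fin k × Fin m → Bool) {A : Set (Fin k × Fin m → Bool)}
    (hA : ∀ s : Finset (Fin k × Fin m), Shatters A s → s.card ≤ d) (htab : ∀ J, tab J ∈ A)
    (hcons : ∀ J l, tab J (J l) = false)
    (hM : M / n + (∑ i ∈ range (d + 1), (2 * n).choose i : ℕ) / 2 ^ M ≤ ((2 : ℝ) ^ (a + 1))⁻¹)
    {ε δ : ℝ} (hε : 0 < ε) (hτ : (4 / 2 ^ a) ^ τ ≤ ε * δ / 16) :
    ((univ.filter fun ω : (Fin (2 * τ) → Fin n → Fin L) × (Fin k → Fin (2 * τ) → Fin n → Fin L) =>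
        ε / 8 * (k * m) < ((univ.filter fun p =>
          callState tab (2 * τ) a (extendSeq (seedsByCall ω)) (2 * τ) p ≤ τ).card : ℝ)).card : ℝ) ≤
      δ / 2 *
        Fintype.card ((Fin (2 * τ) → Fin n → Fin L) × (Fin k → Fin (2 * τ) → Fin n → Fin L)) := by
  have hk : (0 : ℝ) < k := by exact_mod_cast Nat.pos_of_neZero k
  have hm : (0 : ℝ) < m := by exact_mod_cast Nat.pos_of_neZero m
  have h1 := expect_card_half_wrong_le hn (Nat.pos_of_neZero L) hL tab hA htab hcons M hM
  set N : (Fin (2 * τ) → Fin n → Fin L) × (Fin k → Fin (2 * τ) → Fin n → Fin L) → ℝ := fun ω =>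
    ((univ.filter fun p =>
          callState tab (2 * τ) a (extendSeq (seedsByCall ω)) (2 * τ) p ≤ τ).card : ℝ) with hN
  have h2 : 𝔼 ω, N ω ≤ (4 / 2 ^ a) ^ τ * (k * m) := by
    refine le_trans (le_of_eq ?_) h1
    exact Fintype.expect_bijective seedsByCall seedsByCall_bijective _ _ fun ω => rfl
  rw [Fintype.expect_eq_sum_div_card, div_le_iff₀ (by exact_mod_cast Fintype.card_pos)] at h2
  have h3 : ((univ.filter fun ω => ε / 8 * (k * m) < N ω).card : ℝ) * (ε / 8 * (k * m)) ≤
      ∑ ω, N ω := by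
    rw [← nsmul_eq_mul, ← sum_const]
    refine (sum_le_sum fun ω hω => (mem_filter.1 hω).2.le).trans
      (sum_le_sum_of_subset_of_nonneg (filter_subset _ _) fun ω _ _ => Nat.cast_nonneg _)
  set c : ℝ := (Fintype.card
    ((Fin (2 * τ) → Fin n → Fin L) × (Fin k → Fin (2 * τ) → Fin n → Fin L)) : ℝ) with hc
  have hc0 : 0 ≤ c := Nat.cast_nonneg _
  have hpos : 0 < ε / 8 * (k * m) := by positivity
  refine le_of_mul_le_mul_right ?_ hpos
  calc _ ≤ ∑ ω, N ω := h3
    _ ≤ (4 / 2 ^ a) ^ τ * (k * m) * c := h2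
    _ ≤ ε * δ / 16 * (k * m) * c := by gcongr
    _ = _ := by ring

theorem measurable_errorTable {ι : Type*} [MeasurableSpace X] {A : (Fin n → X × Bool) → X → Bool}
    (hA : Measurable fun p : (Fin n → X × Bool) × X => A p.1 p.2) {f : X → Bool}
    (hf : Measurable f) : Measurable fun x : ι → X => errorTable A f x := by
  refine measurable_pi_lambda _ fun J => measurable_pi_lambda _ fun q => ?_
  have h1 : Measurable fun x : ι → X => fitAt A f x J (x q) :=
    (measurable_fitAt hA hf J).comp (measurable_id.prodMk (measurable_pi_apply q))
  have h2 : Measurable fun x : ι → X => f (x q) := hf.comp (measurable_pi_apply q)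
  exact (measurable_from_top (f := fun p : Bool × Bool => p.1 != p.2)).comp
    (show @Measurable _ _ _ ⊤ (fun x : ι → X => (fitAt A f x J (x q), f (x q))) from by
      have h3 : (⊤ : MeasurableSpace (Bool × Bool)) = Prod.instMeasurableSpace := by
        refine le_antisymm (fun s _ => (Set.to_countable s).measurableSet) le_top
      rw [h3]; exact h1.prodMk h2)

/-- Failure has two causes, each of probability at most `δ/2`: unlucky seeds leave more than a
fraction `ε/8` of the pooled sample with at most half of the hypotheses correct, or a vote with
sample error at most `ε/8` overfits. -/
theorem boostProtocol_learns [MeasurableSpace X] {H : Set (X → Bool)} {d M : ℕ}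
    (hmem : ∀ h ∈ H, Measurable h) (hd : HasVCDim H d) (K : MessageCode k n a)
    {A : (Fin n → X × Bool) → X → Bool}
    (hA : Measurable fun p : (Fin n → X × Bool) × X => A p.1 p.2)
    (hcons : ∀ s : Fin n → X × Bool, (∃ h ∈ H, ∀ j, h (s j).1 = (s j).2) →
      A s ∈ H ∧ ∀ j, A s (s j).1 = (s j).2)
    (hn : 0 < n) (hL : ∀ W, 0 < W → W ≤ k * m * 2 ^ (a * (2 * τ)) → W ∣ L)
    (hM : M / n + (∑ i ∈ range (d + 1), (2 * n).choose i : ℕ) / 2 ^ M ≤ ((2 : ℝ) ^ (a + 1))⁻¹)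
    {ε δ : ℝ} (hε : 0 < ε) (hδ : 0 < δ) (hτ : (4 / 2 ^ a) ^ τ ≤ ε * δ / 16)
    (hm : 2 * (n * (2 * τ)) ≤ m)
    (hexp : ((k : ℝ) * m) ^ (2 * τ * n) * Real.exp (-(ε / 8 * (k * m))) ≤ δ / 2) :
    (boostProtocol K m (2 * τ) L A).Learns H ε δ := by
  classical
  intro D hD f hf
  have hfm := hmem f hf
  let Seed : Type := Fin (2 * τ) → Fin n → Fin L
  let mS : MeasurableSpace Seed := ⊤
  have hdS : @DiscreteMeasurableSpace Seed mS := @DiscreteMeasurableSpace.mk _ mS fun _ => trivial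
  have hsS : @MeasurableSingletonClass Seed mS := @MeasurableSingletonClass.mk _ mS fun _ => trivial
  let ν : @Measure Seed mS := uniformSeed Seed
  have hνp : @IsProbabilityMeasure Seed mS ν := (boostProtocol K m (2 * τ) L A).seedLaw_prob
  have hν : ∀ x, ν {x} = (Fintype.card Seed : ℝ≥0∞)⁻¹ := by
    intro x
    have : ν = (PMF.uniformOfFintype Seed).toMeasure := rfl
    rw [this, PMF.toMeasure_apply_singleton _ _ (MeasurableSet.singleton x),
      PMF.uniformOfFintype_apply]
  set E : ((Fin n → Fin k × Fin m) → Fin k × Fin m → Bool) → Set (Seed × (Fin k → Seed)) :=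
    fun tab => (univ.filter fun ω : Seed × (Fin k → Seed) =>
        ε / 8 * (k * m) < ((univ.filter fun p =>
          callState tab (2 * τ) a (extendSeq (seedsByCall ω)) (2 * τ) p ≤ τ).card : ℝ) :
            Finset (Seed × (Fin k → Seed))) with hE
  have hθ : Measurable fun S : Fin k → Fin m → X => errorTable (n := n) A f (Function.uncurry S) :=
    (measurable_errorTable hA hfm).comp (MeasurableEquiv.curry (Fin k) (Fin m) X).symm.measurable
  have hsec : ∀ S : Fin k → Fin m → X, (ν.prod (Measure.pi fun _ : Fin k => ν))
      (E (errorTable A f (Function.uncurry S))) ≤ ENNReal.ofReal (δ / 2) := by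
    intro S
    rw [hE, prod_pi_uniform_apply ν hν]
    have hfit : ∀ J : Fin n → Fin k × Fin m, fitAt A f (Function.uncurry S) J ∈ H ∧
        ∀ l, fitAt A f (Function.uncurry S) J (Function.uncurry S (J l)) =
          f (Function.uncurry S (J l)) := fun J =>
      hcons (fun l => (Function.uncurry S (J l), f (Function.uncurry S (J l))))
        ⟨f, hf, fun _ => rfl⟩
    have h := card_bad_seeds_le (L := L) hn hL (errorTable A f (Function.uncurry S))
      (shatters_errorPatterns_card_le hd f (Function.uncurry S))
      (fun J => ⟨_, (hfit J).1, fun _ => rfl⟩)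
      (fun J l => by simp only [errorTable, (hfit J).2 l, bne_self_eq_false]) hM hε hτ
    have hc : (0 : ℝ) < Fintype.card (Seed × (Fin k → Seed)) := by exact_mod_cast Fintype.card_pos
    rw [← div_eq_mul_inv]
    refine ENNReal.div_le_of_le_mul ?_
    rw [← ENNReal.ofReal_natCast (Fintype.card (Seed × (Fin k → Seed))),
      ← ENNReal.ofReal_mul (by positivity), ← ENNReal.ofReal_natCast]
    exact ENNReal.ofReal_le_ofReal h
  have hbad := (measure_overfit_le (T := 2 * τ) D hA hfm (Nat.pos_of_neZero k) hm hε.le).trans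
    (ENNReal.ofReal_le_ofReal hexp)
  have hlaw : (boostProtocol K m (2 * τ) L A).law D =
      (Measure.pi fun i : Fin k => Measure.pi fun _ : Fin m => D i).prod
        (ν.prod (Measure.pi fun _ : Fin k => ν)) := rfl
  have hsum : ENNReal.ofReal δ = ENNReal.ofReal (δ / 2) + ENNReal.ofReal (δ / 2) := by
    rw [← ENNReal.ofReal_add (by positivity) (by positivity)]; congr 1; ring
  rw [hlaw, hsum]
  refine measure_outcome_le _ _ _ hθ E hbad hsec ?_
  rintro ⟨S, ω⟩ hω
  have hω' : ENNReal.ofReal ε < Protocol.mixture D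
    {x | (boostProtocol K m (2 * τ) L A).hypothesis f (S, ω) x ≠ f x} := hω
  rw [hypothesis_boostProtocol (a := a) K A f S ω] at hω'
  by_cases hS : ω ∈ E (errorTable A f (Function.uncurry S))
  · exact Or.inr hS
  · refine Or.inl ⟨fun t => runPicks (a := a) A f S ω t, ?_, hω'⟩
    simp only [hE, coe_filter, mem_univ, true_and, Set.mem_ofPred_eq, not_lt] at hS
    refine le_trans (Nat.cast_le.2 (card_le_card fun q hq => ?_)) hS
    rw [mem_filter] at hq ⊢
    exact ⟨mem_univ _, runState_le_of_vote_ne A f S ω q hq.2⟩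

end Learn

end DistLearn

namespace DistLearn

open Finset BigOperators

theorem LearnableWithin.mono {X : Type u} [MeasurableSpace X] {H : Set (X → Bool)} {k : ℕ}
    {ε δ R E B R' E' B' : ℝ} (h : LearnableWithin H k ε δ R E B) (hR : R ≤ R') (hE : E ≤ E')
    (hB : B ≤ B') : LearnableWithin H k ε δ R' E' B' := by
  obtain ⟨π, h1, h2, h3, h4⟩ := h
  exact ⟨π, h1.trans hR, fun τ c => (h2 τ c).trans hE, h3.trans hB, h4⟩

/-! ## Parameters of the boosting protocol -/

/-- Each summand is at most `2^(-(a+2))`. The first equals it. In the second, the number of traces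
is at most `(128 e a 2^a)^d ≤ 2^((9+2a)d)`, and the exponent `16da` beats `(9+2a)d + a + 2`. -/
theorem sampleSize_suffices {d a : ℕ} (hd : 0 < d) (ha : 0 < a) :
    ((16 * d * a : ℕ) : ℝ) / (64 * d * a * 2 ^ a : ℕ) +
      (∑ i ∈ range (d + 1), (2 * (64 * d * a * 2 ^ a)).choose i : ℕ) / 2 ^ (16 * d * a) ≤
      ((2 : ℝ) ^ (a + 1))⁻¹ := by
  have hd' : (0 : ℝ) < d := by exact_mod_cast hd
  have ha' : (0 : ℝ) < a := by exact_mod_cast ha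
  have h1 : ((16 * d * a : ℕ) : ℝ) / (64 * d * a * 2 ^ a : ℕ) = ((2 : ℝ) ^ (a + 2))⁻¹ := by
    push_cast
    rw [pow_add]
    field_simp
    norm_num
  have h2 : ((∑ i ∈ range (d + 1), (2 * (64 * d * a * 2 ^ a)).choose i : ℕ) : ℝ) ≤
      2 ^ ((9 + 2 * a) * d) := by
    refine (sum_choose_le hd ?_).trans ?_
    · have : 1 ≤ 2 * (64 * a * 2 ^ a) := Nat.one_le_iff_ne_zero.2 (by positivity)
      calc d = d * 1 := (mul_one d).symm
        _ ≤ d * (2 * (64 * a * 2 ^ a)) := Nat.mul_le_mul_left _ this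
        _ = _ := by ring
    · rw [pow_mul]
      gcongr
      have h3 : ((2 * (64 * d * a * 2 ^ a) : ℕ) : ℝ) / d = 128 * a * 2 ^ a := by
        push_cast; field_simp; norm_num
      rw [h3]
      have h4 : Real.exp 1 ≤ 4 := by linarith [Real.exp_one_lt_d9]
      have h5 : (a : ℝ) ≤ 2 ^ a := by exact_mod_cast (Nat.lt_two_pow_self (n := a)).le
      calc Real.exp 1 * (128 * a * 2 ^ a) ≤ 4 * (128 * 2 ^ a * 2 ^ a) := by gcongr
        _ = 2 ^ (9 + 2 * a) := by rw [pow_add, two_mul, pow_add]; ring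
  have h6 : (9 + 2 * a) * d + (a + 2) ≤ 16 * d * a := by
    have : 1 ≤ d := hd
    have : 1 ≤ a := ha
    nlinarith [Nat.mul_le_mul hd ha]
  have h7 : ((∑ i ∈ range (d + 1), (2 * (64 * d * a * 2 ^ a)).choose i : ℕ) : ℝ) /
      2 ^ (16 * d * a) ≤ ((2 : ℝ) ^ (a + 2))⁻¹ := by
    rw [div_le_iff₀ (by positivity), inv_mul_eq_div, le_div_iff₀ (by positivity)]
    calc _ ≤ (2 : ℝ) ^ ((9 + 2 * a) * d) * 2 ^ (a + 2) := by gcongr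
      _ = 2 ^ ((9 + 2 * a) * d + (a + 2)) := by rw [pow_add _ _ (a + 2)]
      _ ≤ _ := pow_le_pow_right₀ (by norm_num) h6
  have h8 : ((2 : ℝ) ^ (a + 1))⁻¹ = (2 ^ (a + 2))⁻¹ + (2 ^ (a + 2))⁻¹ := by
    rw [pow_succ _ (a + 1)]; field_simp; norm_num
  rw [h8, h1]
  gcongr

/-- Private samples cost no communication, so `m` may grow until the exponential defeats the
polynomial number of choices of positions. -/
theorem exists_sampleSize {k : ℕ} (hk : 0 < k) (q N : ℕ) {ε δ : ℝ} (hε : 0 < ε) (hδ : 0 < δ) :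
    ∃ m : ℕ, 0 < m ∧ N ≤ m ∧
      ((k : ℝ) * m) ^ q * Real.exp (-(ε / 8 * (k * m))) ≤ δ := by
  have hk' : (0 : ℝ) < k := by exact_mod_cast hk
  have h1 : Filter.Tendsto (fun m : ℕ => ε / 8 * (k * (m : ℝ))) Filter.atTop Filter.atTop :=
    (tendsto_natCast_atTop_atTop.const_mul_atTop hk').const_mul_atTop (by positivity)
  have h2 := ((Real.tendsto_pow_mul_exp_neg_atTop_nhds_zero q).comp h1).const_mul ((8 / ε) ^ q)
  rw [mul_zero] at h2
  obtain ⟨m, h3, h4⟩ := ((h2.eventually (gt_mem_nhds hδ)).and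
    (Filter.eventually_ge_atTop (max 1 N))).exists
  refine ⟨m, (le_max_left 1 N).trans h4, (le_max_right 1 N).trans h4, le_of_eq_of_le ?_ h3.le⟩
  have h5 : (k : ℝ) * m = 8 / ε * (ε / 8 * (k * m)) := by field_simp
  change _ = (8 / ε) ^ q * ((ε / 8 * (k * (m : ℝ))) ^ q * Real.exp (-(ε / 8 * (k * (m : ℝ)))))
  have h6 : ((k : ℝ) * m) ^ q = (8 / ε) ^ q * (ε / 8 * (k * m)) ^ q := by rw [← mul_pow, ← h5]
  rw [h6, mul_assoc]

theorem learnableWithin_boost {X : Type u} [MeasurableSpace X] {H : Set (X → Bool)}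
    {d k a τ b b' : ℕ} (hH : IsMeasurableClass H) (hd : HasVCDim H d) (hd0 : 0 < d) (hk : 0 < k)
    (ha : 0 < a) {ε δ : ℝ} (hε : 0 < ε) (hδ : 0 < δ) (hτ : (4 / 2 ^ a) ^ τ ≤ ε * δ / 16)
    (hb : 64 * d * a * 2 ^ a + 1 ≤ 2 ^ b) (hb' : a + 1 ≤ 2 ^ b') :
    LearnableWithin H k ε δ (4 * τ) (64 * d * a * 2 ^ a) (k * (b + b')) := by
  set n := 64 * d * a * 2 ^ a with hn
  have hn0 : 0 < n := by positivity
  obtain ⟨A, hA, hcons⟩ := hH.measurable_consistent n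
  obtain ⟨K, hK1, hK2⟩ := exists_messageCode k n a b b' hb hb'
  obtain ⟨m, hm0, hm, hexp⟩ := exists_sampleSize hk (2 * τ * n) (2 * (n * (2 * τ))) hε
    (half_pos hδ)
  have : NeZero k := ⟨hk.ne'⟩
  have : NeZero m := ⟨hm0.ne'⟩
  -- The factorial as the number of seed values is divisible by every total weight that can occur.
  have : NeZero (k * m * 2 ^ (a * (2 * τ))).factorial := ⟨Nat.factorial_ne_zero _⟩
  refine ⟨boostProtocol K m (2 * τ) (k * m * 2 ^ (a * (2 * τ))).factorial A, ?_, fun σ c => ?_, ?_,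
    boostProtocol_learns hH.measurable_mem hd K hA hcons hn0
      (fun W hW hW' => Nat.dvd_factorial hW hW') (sampleSize_suffices hd0 ha) hε hδ hτ hm hexp⟩
  · have : (boostProtocol K m (2 * τ) (k * m * 2 ^ (a * (2 * τ))).factorial A).rounds =
      4 * τ := by change 2 * (2 * τ) = _; ring
    rw [this]; push_cast; exact le_rfl
  · have h1 : ((∑ i, (boostProtocol K m (2 * τ) (k * m * 2 ^ (a * (2 * τ))).factorial A).request
      σ c i : ℕ) : ℝ) ≤ n := by exact_mod_cast boostProtocol_request_le K A σ c
    refine h1.trans (le_of_eq ?_)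
    rw [hn]; push_cast; ring
  · change ((K.centerBits + k * K.playerBits : ℕ) : ℝ) ≤ _
    rw [hK1, hK2]
    push_cast
    exact le_of_eq (by ring)

/-- Learning with a boosting protocol whose weak hypotheses have error about `β`. -/
theorem learnableWithin_of_beta {X : Type u} [MeasurableSpace X] {H : Set (X → Bool)}
    {d k : ℕ} (hH : IsMeasurableClass H) (hd : HasVCDim H d) (hd0 : 0 < d) (hk : 0 < k)
    {β ε δ : ℝ} (hβ : 0 < β) (hβ' : β ≤ 1 / 16) (hε : 0 < ε) (hε1 : ε < 1) (hδ : 0 < δ)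
    (hδ1 : δ < 1) :
    LearnableWithin H k ε δ (8 * (Real.log (1 / ε) / Real.log (1 / β)) + (4 + 8 * Real.log (16 / δ)))
      (384 * (d / β * Real.log (1 / β))) (12 * (k * Real.log (d / β))) := by
  have hl2 := Real.log_two_gt_d9
  have hl2' := Real.log_two_lt_d9
  have hd1 : (1 : ℝ) ≤ d := by exact_mod_cast hd0
  set ℓ := Real.log (1 / β) with hℓ
  have hβ16 : 16 ≤ 1 / β := by rw [le_div_iff₀ hβ]; linarith
  have hℓ16 : 4 * Real.log 2 ≤ ℓ := by
    have : 4 * Real.log 2 = Real.log 16 := by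
      rw [show (16 : ℝ) = 2 ^ 4 by norm_num, Real.log_pow]; norm_num
    rw [this]
    exact Real.log_le_log (by norm_num) hβ16
  have hℓpos : 0 < ℓ := by linarith
  set a := ⌈ℓ / Real.log 2⌉₊ with ha
  have ha1 : ℓ / Real.log 2 ≤ a := Nat.le_ceil _
  have ha2 : (a : ℝ) < ℓ / Real.log 2 + 1 := Nat.ceil_lt_add_one (by positivity)
  have hadiv : ℓ / Real.log 2 * Real.log 2 = ℓ := by field_simp
  have ha3 : (a : ℝ) ≤ 3 * ℓ := by
    have : ℓ / Real.log 2 ≤ 3 / 2 * ℓ := by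
      rw [div_le_iff₀ (by linarith)]; nlinarith
    linarith
  have ha0 : 0 < a := Nat.ceil_pos.2 (by positivity)
  have hpow1 : 1 / β ≤ 2 ^ a := by
    rw [← Real.log_le_log_iff (by positivity) (by positivity), Real.log_pow]
    nlinarith
  have hpow2 : (2 : ℝ) ^ a ≤ 2 * (1 / β) := by
    rw [← Real.log_le_log_iff (by positivity) (by positivity), Real.log_pow,
      Real.log_mul (by norm_num) (by positivity)]
    nlinarith
  -- Since `β ≤ 1/16`, the rate `4/2^a ≤ 4β` is at most `√β`; this many factors `√β` reach `εδ/16`.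
  set τ := ⌈2 * Real.log (16 / (ε * δ)) / ℓ⌉₊ with hτ
  have hlogpos : 0 ≤ Real.log (16 / (ε * δ)) := Real.log_nonneg (by
    rw [le_div_iff₀ (by positivity)]; nlinarith)
  have hτ1 : 2 * Real.log (16 / (ε * δ)) / ℓ ≤ τ := Nat.le_ceil _
  have hτ2 : (τ : ℝ) ≤ 2 * Real.log (16 / (ε * δ)) / ℓ + 1 :=
    (Nat.ceil_lt_add_one (by positivity)).le
  have hτpow : (4 / 2 ^ a : ℝ) ^ τ ≤ ε * δ / 16 := by
    have h4 : (4 / 2 ^ a : ℝ) ≤ 4 * β := by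
      rw [div_le_iff₀ (by positivity)]
      have : 1 ≤ 2 ^ a * β := by rwa [div_le_iff₀ hβ] at hpow1
      linarith
    refine (pow_le_pow_left₀ (by positivity) h4 τ).trans ?_
    rw [← Real.log_le_log_iff (by positivity) (by positivity), Real.log_pow,
      Real.log_mul (by norm_num) hβ.ne']
    have h5 : Real.log (ε * δ / 16) = - Real.log (16 / (ε * δ)) := by
      rw [← Real.log_inv, inv_div]
    have h6 : Real.log β = -ℓ := by rw [hℓ, one_div, Real.log_inv]; ring
    have h7 : Real.log 4 = 2 * Real.log 2 := by
      rw [show (4 : ℝ) = 2 ^ 2 by norm_num, Real.log_pow]; norm_num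
    rw [h5, h6, h7]
    rw [div_le_iff₀ hℓpos] at hτ1
    have h8 : (τ : ℝ) * (2 * Real.log 2 + -ℓ) ≤ τ * (-(ℓ / 2)) :=
      mul_le_mul_of_nonneg_left (by linarith) (Nat.cast_nonneg _)
    linarith
  set n := 64 * d * a * 2 ^ a with hn
  have hxn : (n : ℝ) ≤ 384 * (d / β * ℓ) := by
    rw [hn]; push_cast
    calc (64 * d * a * 2 ^ a : ℝ) ≤ 64 * d * (3 * ℓ) * (2 * (1 / β)) := by gcongr
      _ = _ := by ring
  have hb : n + 1 ≤ 2 ^ Nat.clog 2 (n + 1) := Nat.le_pow_clog (by norm_num) _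
  have hn1 : 1 ≤ n := by
    rw [hn]; exact Nat.one_le_iff_ne_zero.2 (by positivity)
  have hblog : (Nat.clog 2 (n + 1) : ℝ) ≤ 9 * Real.log (d / β) := by
    set y := (d : ℝ) / β with hy
    have hy16 : 16 ≤ y := hβ16.trans (by rw [hy]; gcongr)
    have hypos : 0 < y := by linarith
    have h1 : (2 : ℝ) ^ Nat.clog 2 (n + 1) ≤ 2 * (n + 1) := by
      have h2 := Nat.pow_pred_clog_lt_self (b := 2) (by norm_num) (x := n + 1) (by omega)
      have h3 : 0 < Nat.clog 2 (n + 1) := Nat.clog_pos (by norm_num) (by omega)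
      have h4 : 2 ^ Nat.clog 2 (n + 1) ≤ 2 * (n + 1) := by
        obtain ⟨c, hc⟩ : ∃ c, Nat.clog 2 (n + 1) = c + 1 := ⟨_, (Nat.succ_pred_eq_of_pos h3).symm⟩
        rw [hc] at h2 ⊢
        rw [pow_succ]
        simp only [Nat.pred_eq_sub_one, Nat.add_sub_cancel] at h2
        omega
      exact_mod_cast h4
    have hℓy : ℓ ≤ y := by
      have h5 : ℓ ≤ 1 / β := (Real.log_le_sub_one_of_pos (by positivity)).trans (by linarith)
      exact h5.trans (by rw [hy]; gcongr)
    -- The crude exponent 6 leads to the constant 9, because `6 / log 2 < 9`.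
    have h6 : (2 : ℝ) ^ Nat.clog 2 (n + 1) ≤ y ^ 6 := by
      have h7 : (n : ℝ) ≤ 384 * (y * y) := hxn.trans (by gcongr)
      have h8 : (16 : ℝ) ^ 4 ≤ y ^ 4 := pow_le_pow_left₀ (by norm_num) hy16 4
      have h9 : (256 : ℝ) ≤ y * y := by nlinarith
      have h10 : y ^ 6 = y ^ 4 * (y * y) := by ring
      rw [h10]
      nlinarith
    have h11 := Real.log_le_log (by positivity) h6
    rw [Real.log_pow, Real.log_pow] at h11
    have h12 : 0 ≤ Real.log y := Real.log_nonneg (by linarith)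
    have h13 : (0 : ℝ) ≤ Nat.clog 2 (n + 1) := Nat.cast_nonneg _
    push_cast at h11
    nlinarith
  -- Spending `a` bits on `a + 1` possible drops is wasteful but affordable, since `a` is of order
  -- `log (1/β)`.
  have hmain := learnableWithin_boost hH hd hd0 hk ha0 hε hδ hτpow hb
    (Nat.lt_two_pow_self (n := a))
  have hℓd : ℓ ≤ Real.log (d / β) := Real.log_le_log (by positivity) (by gcongr)
  refine hmain.mono ?_ ?_ ?_
  · have h1 : Real.log (16 / (ε * δ)) = Real.log (1 / ε) + Real.log (16 / δ) := by
      rw [← Real.log_mul (by positivity) (by positivity)]; congr 1; field_simp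
    have h2 : 0 ≤ Real.log (16 / δ) := Real.log_nonneg (by
      rw [le_div_iff₀ hδ]; linarith)
    have h3 : Real.log (16 / δ) / ℓ ≤ Real.log (16 / δ) := div_le_self h2 (by linarith)
    rw [h1, mul_add, add_div, mul_div_assoc, mul_div_assoc] at hτ2
    linarith
  · refine le_of_eq_of_le ?_ hxn
    rw [hn]; push_cast; ring
  · have hk' : (0 : ℝ) ≤ k := Nat.cast_nonneg _
    calc (k : ℝ) * (Nat.clog 2 (n + 1) + a) ≤ k * (12 * Real.log (d / β)) := by
          gcongr; linarith
      _ = _ := by ring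

/-- Learning with a boosting protocol whose weak hypotheses have constant error. -/
theorem learnableWithin_const {X : Type u} [MeasurableSpace X] {H : Set (X → Bool)}
    {d k : ℕ} (hH : IsMeasurableClass H) (hd : HasVCDim H d) (hd0 : 0 < d) (hk : 0 < k)
    {ε δ : ℝ} (hε : 0 < ε) (hε1 : ε < 1) (hδ : 0 < δ) (hδ1 : δ < 1) :
    LearnableWithin H k ε δ (8 * (Real.log (1 / ε) / Real.log 16) + (4 + 8 * Real.log (16 / δ)))
      (18432 * d) (12 * (k * Real.log (16 * d))) := by
  have h := learnableWithin_of_beta hH hd hd0 hk (β := 1 / 16) (by norm_num) le_rfl hε hε1 hδ hδ1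
  have h16 : Real.log 16 ≤ 3 := by
    rw [show (16 : ℝ) = 2 ^ 4 by norm_num, Real.log_pow]
    have := Real.log_two_lt_d9
    push_cast; linarith
  rw [show (1 : ℝ) / (1 / 16) = 16 by norm_num] at h
  refine h.mono le_rfl ?_ ?_
  · have : (0 : ℝ) ≤ d := Nat.cast_nonneg _
    rw [show (d : ℝ) / (1 / 16) = 16 * d by ring]
    nlinarith
  · rw [show (d : ℝ) / (1 / 16) = 16 * d by ring]

end DistLearn

namespace DistLearn

open Finset BigOperators

/-! ## Protocols without communication -/

/-- The protocol that outputs a fixed hypothesis. -/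
noncomputable def constProtocol {X : Type u} (k : ℕ) (g : X → Bool) : Protocol X k where
  rounds := 0
  sampleSize := 0
  centerBits := 0
  playerBits := 0
  Seed := Unit
  seedSpace := ⊤
  seedLaw := Measure.dirac ()
  seedLaw_prob := inferInstance
  centerMsg _ _ := fun _ => false
  request _ _ _ := 0
  pick _ _ _ _ _ := []
  length_pick _ _ _ _ _ := rfl
  playerMsg _ _ _ _ _ := fun _ => false
  output _ := g

theorem learnableWithin_of_const {X : Type u} [MeasurableSpace X] {H : Set (X → Bool)} {k : ℕ}
    {ε δ R E B : ℝ} (g : X → Bool)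
    (hg : ∀ D : Fin k → Measure X, (∀ i, IsProbabilityMeasure (D i)) → ∀ f ∈ H,
      Protocol.mixture D {x | g x ≠ f x} ≤ ENNReal.ofReal ε)
    (hR : 0 ≤ R) (hE : 0 ≤ E) (hB : 0 ≤ B) : LearnableWithin H k ε δ R E B := by
  refine ⟨constProtocol k g, by simpa [constProtocol] using hR,
    fun _ _ => by simpa [constProtocol] using hE, by simpa [constProtocol] using hB,
    fun D hD f hf => ?_⟩
  have h : {ω : (constProtocol k g).Outcome | ENNReal.ofReal ε <
      Protocol.mixture D {x | (constProtocol k g).hypothesis f ω x ≠ f x}} = ∅ :=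
    Set.eq_empty_of_forall_notMem fun ω hω => absurd (hg D hD f hf) (not_le.2 hω)
  rw [h, measure_empty]
  exact zero_le

theorem mixture_le_one {X : Type u} [MeasurableSpace X] {k : ℕ} (hk : 0 < k)
    (D : Fin k → Measure X) (hD : ∀ i, IsProbabilityMeasure (D i)) (s : Set X) :
    Protocol.mixture D s ≤ 1 := by
  rw [Protocol.mixture, Measure.smul_apply, Measure.finsetSum_apply, smul_eq_mul]
  calc (k : ℝ≥0∞)⁻¹ * ∑ i, D i s ≤ (k : ℝ≥0∞)⁻¹ * ∑ _i : Fin k, 1 := by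
        gcongr with i; exact prob_le_one
    _ = 1 := by
        simp only [sum_const, card_univ, Fintype.card_fin, nsmul_eq_mul, mul_one]
        exact ENNReal.inv_mul_cancel (by simpa using hk.ne') (by simp)

/-- A class of VC dimension 0 has a single member. -/
theorem learnableWithin_of_vcDim_zero {X : Type u} [MeasurableSpace X] {H : Set (X → Bool)} {k : ℕ}
    (hd : HasVCDim H 0) {ε δ R E B : ℝ} (hR : 0 ≤ R) (hE : 0 ≤ E) (hB : 0 ≤ B) :
    LearnableWithin H k ε δ R E B := by
  obtain ⟨S, -, hS⟩ := hd.1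
  obtain ⟨g, hg, -⟩ := hS fun _ => false
  refine learnableWithin_of_const g (fun D _ f hf => ?_) hR hE hB
  have hfg : ∀ x, g x = f x := by
    intro x
    by_contra hne
    have hsh : Shatters H {x} := by
      intro b
      by_cases hb : g x = b x
      · exact ⟨g, hg, by simpa using hb⟩
      · refine ⟨f, hf, ?_⟩
        simp only [mem_singleton, forall_eq]
        revert hne hb
        cases g x <;> cases f x <;> cases b x <;> simp
    have := hd.2 ⟨{x}, rfl, hsh⟩
    simp at this
  simp [hfg]

/-! ## Finite domains -/

/-- Points that no member of the class distinguishes from `x`. -/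
def sameBehaviour {X : Type u} (H : Set (X → Bool)) (x : X) : Set X := {z | ∀ h ∈ H, h z = h x}

theorem measurableSet_sameBehaviour {X : Type u} [Finite X] [MeasurableSpace X]
    {H : Set (X → Bool)} (hH : ∀ h ∈ H, Measurable h) (x : X) :
    MeasurableSet (sameBehaviour H x) := by
  have h : sameBehaviour H x = ⋂ h ∈ H, h ⁻¹' {h x} := by
    ext z; simp [sameBehaviour]
  rw [h]
  exact MeasurableSet.biInter (Set.to_countable H) fun g hg => hH g hg (MeasurableSet.singleton _)

/-- The hypothesis read off a transcript in which the players announce positive points one by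
one. -/
def announced {X : Type u} {k N cb : ℕ} (e : X ≃ Fin N) :
    List (RoundRecord X k cb 1) → X → Bool
  | [], _ => false
  | r :: τ, x => announced e τ x ||
      (decide (τ.length = (e x).val) && decide (∃ i, r.bits i 0 = true))

open scoped Classical in
/-- The protocol in which the players announce, for one point after the other, whether they have
seen a positive example that the class does not distinguish from it. -/
noncomputable def announceProtocol {X : Type u} (H : Set (X → Bool)) (k m : ℕ) {N : ℕ}
    (e : X ≃ Fin N) : Protocol X k where
  rounds := N
  sampleSize := m
  centerBits := 0
  playerBits := 1
  Seed := Unit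
  seedSpace := ⊤
  seedLaw := Measure.dirac ()
  seedLaw_prob := inferInstance
  centerMsg _ _ := fun _ => false
  request _ _ _ := 0
  pick _ _ _ _ _ := []
  length_pick _ _ _ _ _ := rfl
  playerMsg _ τ _ s _ := fun _ =>
    decide (∃ x, (e x).val = τ.length ∧ ∃ j, (s j).1 ∈ sameBehaviour H x ∧ (s j).2 = true)
  output τ := announced e τ

theorem announced_transcript {X : Type u} (H : Set (X → Bool)) {k m N : ℕ}
    (e : X ≃ Fin N) (f : X → Bool) (ω : (announceProtocol H k m e).Outcome) (n : ℕ) (x : X) :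
    announced e ((announceProtocol H k m e).transcript f ω n) x = true ↔
      (e x).val < n ∧ ∃ i j, ω.1 i j ∈ sameBehaviour H x ∧ f (ω.1 i j) = true := by
  classical
  induction n with
  | zero => simp [Protocol.transcript, announced]
  | succ n ih =>
    have hlen : ((announceProtocol H k m e).transcript f ω n).length = n :=
      length_transcript _ _ _ _
    have hbit : ((e x).val = n) → ∀ i, ((announceProtocol H k m e).playerMsg i
        ((announceProtocol H k m e).transcript f ω n)
        ((announceProtocol H k m e).centerMsg ((announceProtocol H k m e).transcript f ω n) ω.2.1)
        ((announceProtocol H k m e).sample f ω i) (ω.2.2 i) (0 : Fin 1) = true ↔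
        ∃ j, ω.1 i j ∈ sameBehaviour H x ∧ f (ω.1 i j) = true) := by
      intro hx i
      change decide (∃ z, (e z).val = ((announceProtocol H k m e).transcript f ω n).length ∧
        ∃ j, ω.1 i j ∈ sameBehaviour H z ∧ f (ω.1 i j) = true) = true ↔ _
      rw [decide_eq_true_iff, hlen]
      constructor
      · rintro ⟨z, hz, h⟩
        have : z = x := e.injective (Fin.ext (hz.trans hx.symm))
        exact this ▸ h
      · exact fun h => ⟨x, hx, h⟩
    change (announced e ((announceProtocol H k m e).transcript f ω n) x ||
      (decide (((announceProtocol H k m e).transcript f ω n).length = (e x).val) &&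
        decide (∃ i, (announceProtocol H k m e).playerMsg i
          ((announceProtocol H k m e).transcript f ω n)
          ((announceProtocol H k m e).centerMsg ((announceProtocol H k m e).transcript f ω n) ω.2.1)
          ((announceProtocol H k m e).sample f ω i) (ω.2.2 i) (0 : Fin 1) = true))) = true ↔ _
    rw [Bool.or_eq_true, ih, Bool.and_eq_true, decide_eq_true_iff,
      decide_eq_true_iff, hlen]
    constructor
    · rintro (⟨h1, h2⟩ | ⟨h1, i, h2⟩)
      · exact ⟨by omega, h2⟩
      · exact ⟨by omega, i, (hbit h1.symm i).1 h2⟩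
    · rintro ⟨h1, i, h2⟩
      rcases Nat.lt_succ_iff_lt_or_eq.1 h1 with h | h
      · exact Or.inl ⟨h, i, h2⟩
      · exact Or.inr ⟨h.symm, i, (hbit h i).2 h2⟩

/-- The probability is `∏ (1 - D_i(s))^m ≤ exp(-m ∑ D_i(s))`, and the sum of the `D_i(s)` is at
least their mean. -/
theorem measure_unseen_le {X : Type u} [MeasurableSpace X] {k m : ℕ} (hk : 0 < k)
    (D : Fin k → Measure X) [∀ i, IsProbabilityMeasure (D i)] {s : Set X} (hs : MeasurableSet s)
    {c : ℝ} (hc : 0 ≤ c) (h : ENNReal.ofReal c < Protocol.mixture D s) :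
    (Measure.pi fun i : Fin k => Measure.pi fun _ : Fin m => D i) {S | ∀ i j, S i j ∉ s} ≤
      ENNReal.ofReal (Real.exp (-(m * c))) := by
  have hk' : (0 : ℝ) < k := by exact_mod_cast hk
  have hset : {S : Fin k → Fin m → X | ∀ i j, S i j ∉ s} =
      Set.univ.pi fun _ => Set.univ.pi fun _ => sᶜ := by
    ext S; simp
  have hr0 : ∀ i, 0 ≤ (D i).real s := fun i => measureReal_nonneg
  have hsum : c ≤ ∑ i, (D i).real s := by
    have h3 : Protocol.mixture D s = ENNReal.ofReal ((∑ i, (D i).real s) / k) := by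
      rw [Protocol.mixture, Measure.smul_apply, Measure.finsetSum_apply, smul_eq_mul,
        div_eq_inv_mul, ENNReal.ofReal_mul (by positivity), ENNReal.ofReal_inv_of_pos hk',
        ENNReal.ofReal_natCast, ENNReal.ofReal_sum_of_nonneg fun i _ => hr0 i]
      simp
    rw [h3] at h
    have h4 := (ENNReal.ofReal_lt_ofReal_iff_of_nonneg hc).1 h
    exact h4.le.trans (div_le_self (sum_nonneg fun i _ => hr0 i) (by exact_mod_cast hk))
  have hcompl : ∀ i, D i sᶜ ≤ ENNReal.ofReal (Real.exp (-(D i).real s)) := by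
    intro i
    rw [← ofReal_measureReal, probReal_compl_eq_one_sub hs]
    exact ENNReal.ofReal_le_ofReal (by linarith [Real.add_one_le_exp (-(D i).real s)])
  rw [hset, Measure.pi_pi]
  calc ∏ i, (Measure.pi fun _ : Fin m => D i) (Set.univ.pi fun _ => sᶜ)
      = ∏ i, (D i sᶜ) ^ m := by simp [Measure.pi_pi]
    _ ≤ ∏ i, ENNReal.ofReal (Real.exp (-(D i).real s)) ^ m :=
        prod_le_prod' fun i _ => pow_le_pow_left' (hcompl i) m
    _ = ENNReal.ofReal (Real.exp (-(m * ∑ i, (D i).real s))) := by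
        rw [prod_pow, ← ENNReal.ofReal_prod_of_nonneg fun i _ => (Real.exp_pos _).le,
          ← Real.exp_sum, ← ENNReal.ofReal_pow (Real.exp_pos _).le, ← Real.exp_nat_mul,
          sum_neg_distrib, mul_neg]
    _ ≤ _ := ENNReal.ofReal_le_ofReal (Real.exp_le_exp.2 (by
        have : (m : ℝ) * c ≤ m * ∑ i, (D i).real s := by gcongr
        linarith))

/-- This covers domains too small for the lower bound on calls. Singletons need not be measurable,
so points are grouped into the measurable classes that `H` does not separate. For large `m` every
class of mass above `ε/(N+1)` is likely to be seen, seen classes are labelled correctly, and the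
other classes have total mass at most `ε`. -/
theorem learnableWithin_of_finite {X : Type u} [Fintype X] [MeasurableSpace X]
    {H : Set (X → Bool)} (hH : ∀ h ∈ H, Measurable h) {k : ℕ} (hk : 0 < k) {ε δ : ℝ} (hε : 0 < ε)
    (hδ : 0 < δ) : LearnableWithin H k ε δ (Fintype.card X) 0 k := by
  classical
  set N := Fintype.card X with hN
  let e : X ≃ Fin N := Fintype.equivFin X
  set c : ℝ := ε / (N + 1) with hc
  have hc0 : 0 < c := by positivity
  have hlim : Filter.Tendsto (fun m : ℕ => (N : ℝ) * Real.exp (-(m * c))) Filter.atTop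
      (nhds 0) := by
    have h1 : Filter.Tendsto (fun m : ℕ => (m : ℝ) * c) Filter.atTop Filter.atTop :=
      tendsto_natCast_atTop_atTop.atTop_mul_const hc0
    simpa using (Real.tendsto_exp_neg_atTop_nhds_zero.comp h1).const_mul (N : ℝ)
  obtain ⟨m, hm⟩ := (hlim.eventually (gt_mem_nhds hδ)).exists
  refine ⟨announceProtocol H k m e, le_rfl, fun _ _ => by simp [announceProtocol],
    by simp [announceProtocol], fun D hD f hf => ?_⟩
  let μ : Measure (Fin k → Fin m → X) := Measure.pi fun i => Measure.pi fun _ => D i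
  let ρ : Measure (Unit × (Fin k → Unit)) :=
    (Measure.dirac ()).prod (Measure.pi fun _ : Fin k => Measure.dirac ())
  let Big : Finset X := univ.filter fun x =>
    ENNReal.ofReal c < Protocol.mixture D (sameBehaviour H x)
  have hsub : {ω : (announceProtocol H k m e).Outcome | ENNReal.ofReal ε <
      Protocol.mixture D {x | (announceProtocol H k m e).hypothesis f ω x ≠ f x}} ⊆
      (⋃ x ∈ Big, {S : Fin k → Fin m → X | ∀ i j, S i j ∉ sameBehaviour H x}) ×ˢ Set.univ := by
    intro ω hω
    refine ⟨?_, trivial⟩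
    by_contra hcon
    have hseen : ∀ x ∈ Big, ∃ i j, ω.1 i j ∈ sameBehaviour H x := by
      intro x hx
      by_contra hno
      push Not at hno
      exact hcon (Set.mem_biUnion hx hno)
    have hyp : ∀ z, (∃ i j, ω.1 i j ∈ sameBehaviour H z) →
        (announceProtocol H k m e).hypothesis f ω z = f z := by
      rintro z ⟨i, j, hij⟩
      have h1 : (announceProtocol H k m e).hypothesis f ω z = true ↔
          (e z).val < N ∧ ∃ i j, ω.1 i j ∈ sameBehaviour H z ∧ f (ω.1 i j) = true :=
        announced_transcript H e f ω N z
      rw [Bool.eq_iff_iff, h1]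
      constructor
      · rintro ⟨-, i', j', h2, h3⟩
        rw [← h2 f hf]; exact h3
      · exact fun h2 => ⟨(e z).isLt, i, j, hij, (hij f hf).trans h2⟩
    have herr : {x | (announceProtocol H k m e).hypothesis f ω x ≠ f x} ⊆
        ⋃ x ∈ Bigᶜ, sameBehaviour H x := by
      intro z hz
      refine Set.mem_biUnion (x := z) ?_ fun _ _ => rfl
      rw [mem_coe, mem_compl]
      exact fun hzB => hz (hyp z (hseen z hzB))
    have hle : Protocol.mixture D {x | (announceProtocol H k m e).hypothesis f ω x ≠ f x} ≤
        ENNReal.ofReal ε := by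
      calc _ ≤ Protocol.mixture D (⋃ x ∈ Bigᶜ, sameBehaviour H x) := measure_mono herr
        _ ≤ ∑ x ∈ Bigᶜ, Protocol.mixture D (sameBehaviour H x) := measure_biUnion_finset_le _ _
        _ ≤ ∑ _x ∈ Bigᶜ, ENNReal.ofReal c := sum_le_sum fun x hx => by
            have : x ∉ Big := mem_compl.1 hx
            simpa [Big] using this
        _ ≤ ∑ _x : X, ENNReal.ofReal c := sum_le_sum_of_subset (subset_univ _)
        _ = ENNReal.ofReal (N * c) := by
            rw [sum_const, nsmul_eq_mul, ENNReal.ofReal_mul (by positivity), ENNReal.ofReal_natCast,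
              card_univ]
        _ ≤ ENNReal.ofReal ε := by
            refine ENNReal.ofReal_le_ofReal ?_
            rw [hc, mul_div_assoc', div_le_iff₀ (by positivity)]
            nlinarith
    exact absurd hle (not_le.2 hω)
  refine le_trans (b := (μ.prod ρ)
    ((⋃ x ∈ Big, {S : Fin k → Fin m → X | ∀ i j, S i j ∉ sameBehaviour H x}) ×ˢ Set.univ))
    (measure_mono (μ := μ.prod ρ) hsub) ?_
  rw [Measure.prod_prod]
  have h2 : (Measure.pi fun i : Fin k => Measure.pi fun _ : Fin m => D i)
      (⋃ x ∈ Big, {S : Fin k → Fin m → X | ∀ i j, S i j ∉ sameBehaviour H x}) ≤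
      ENNReal.ofReal δ := by
    calc _ ≤ ∑ x ∈ Big, (Measure.pi fun i : Fin k => Measure.pi fun _ : Fin m => D i)
          {S : Fin k → Fin m → X | ∀ i j, S i j ∉ sameBehaviour H x} :=
          measure_biUnion_finset_le _ _
      _ ≤ ∑ _x ∈ Big, ENNReal.ofReal (Real.exp (-(m * c))) := sum_le_sum fun x hx =>
          measure_unseen_le hk D (measurableSet_sameBehaviour hH x) hc0.le (mem_filter.1 hx).2
      _ ≤ ∑ _x : X, ENNReal.ofReal (Real.exp (-(m * c))) := sum_le_sum_of_subset (subset_univ _)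
      _ = ENNReal.ofReal (N * Real.exp (-(m * c))) := by
          rw [sum_const, nsmul_eq_mul, ENNReal.ofReal_mul (by positivity), ENNReal.ofReal_natCast,
            card_univ]
      _ ≤ _ := ENNReal.ofReal_le_ofReal hm.le
  calc _ ≤ ENNReal.ofReal δ * 1 := by gcongr; exact prob_le_one
    _ = _ := mul_one _

/-! ## A lower bound on the number of calls of a weight-based booster -/

section LowerBound

variable {X : Type u} {H : Set (X → Bool)} {r : ℕ} {B : WeightBooster r} {β ε : ℝ}

/-- If all weak hypotheses are correct at a point, so is the final hypothesis. -/
theorem WeightBooster.Achieves.combine_const (hB : B.Achieves H β ε) (hβ : 0 ≤ β) (hε : ε < 1)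
    {f : X → Bool} (hf : f ∈ H) (x : X) : B.combine (fun _ => f x) = f x := by
  by_contra hne
  have h := hB f hf 1 (fun _ => x) (fun _ => f) fun t => by
    simp only [ne_eq, not_true_eq_false, if_false, sum_const_zero]
    exact mul_nonneg hβ (sum_nonneg fun _ _ => B.weight_nonneg _ _)
  rw [filter_true_of_mem fun _ _ => hne] at h
  simp at h
  linarith

theorem exists_both_labels {d : ℕ} (hd : HasVCDim H d) (hd0 : 0 < d) :
    ∃ x, (∃ f ∈ H, f x = true) ∧ ∃ f ∈ H, f x = false := by
  obtain ⟨S, hS, hsh⟩ := hd.1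
  obtain ⟨x, hx⟩ := card_pos.1 (hS ▸ hd0)
  obtain ⟨f, hf, hfx⟩ := hsh fun _ => true
  obtain ⟨g, hg, hgx⟩ := hsh fun _ => false
  exact ⟨x, ⟨f, hf, hfx x hx⟩, g, hg, hgx x hx⟩

theorem WeightBooster.Achieves.combine_eq (hB : B.Achieves H β ε) (hβ : 0 ≤ β) (hε : ε < 1)
    {d : ℕ} (hd : HasVCDim H d) (hd0 : 0 < d) (b : Bool) : B.combine (fun _ => b) = b := by
  obtain ⟨x, ⟨f, hf, hfx⟩, g, hg, hgx⟩ := exists_both_labels hd hd0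
  cases b
  · simpa [hgx] using hB.combine_const hβ hε hg x
  · simpa [hfx] using hB.combine_const hβ hε hf x

theorem WeightBooster.Achieves.calls_pos (hB : B.Achieves H β ε) (hβ : 0 ≤ β) (hε : ε < 1)
    {d : ℕ} (hd : HasVCDim H d) (hd0 : 0 < d) : 0 < r := by
  rcases Nat.eq_zero_or_pos r with rfl | h
  · have h1 := hB.combine_eq hβ hε hd hd0 true
    have h2 := hB.combine_eq hβ hε hd hd0 false
    rw [Subsingleton.elim (fun _ : Fin 0 => true) fun _ => false, h2] at h1
    exact absurd h1 (by simp)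
  · exact h

/-- On a domain with more than `r` points an oracle can err in all `r` calls on one of them, whose
share of the sample decreases by a factor of `⌈1/β⌉` per call. -/
theorem WeightBooster.Achieves.one_le_mul_pow (hB : B.Achieves H β ε) (hβ : 0 < β) (hε : ε < 1)
    {d : ℕ} (hd : HasVCDim H d) (hd0 : 0 < d) (x : Fin (r + 1) ↪ X) :
    1 ≤ ε * (⌈1 / β⌉₊ : ℝ) ^ r := by
  classical
  set q := ⌈1 / β⌉₊ with hq
  have hqpos : 0 < q := Nat.ceil_pos.2 (by positivity)
  have hβq : 1 ≤ β * q := by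
    have := Nat.le_ceil (1 / β)
    rw [div_le_iff₀ hβ] at this
    linarith
  obtain ⟨-, ⟨f, hf, -⟩, -⟩ := exists_both_labels hd hd0
  -- Exactly `q^(r-t)` of the `q^r` examples have level at least `t`. All examples of one level are
  -- copies of one point, hence the need for `r + 1` points.
  let level : ℕ → ℕ := fun p => Nat.findGreatest (fun t => p < q ^ (r - t)) r
  have hlevel_le : ∀ p, level p ≤ r := fun p => Nat.findGreatest_le r
  have hlevel : ∀ p < q ^ r, ∀ t ≤ r, t ≤ level p ↔ p < q ^ (r - t) := by
    intro p hp t ht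
    constructor
    · intro h
      have h1 : p < q ^ (r - level p) :=
        Nat.findGreatest_spec (P := fun t => p < q ^ (r - t)) (Nat.zero_le r) hp
      exact h1.trans_le (Nat.pow_le_pow_right hqpos (by omega))
    · exact fun h => Nat.le_findGreatest ht h
  let S : Fin (q ^ r) → X := fun p => x ⟨level p, Nat.lt_succ_of_le (hlevel_le p)⟩
  -- Call `t` errs exactly on the levels above `t`.
  let h : Fin r → X → Bool := fun t z => if ∃ j : Fin (r + 1), t.val < j.val ∧ z = x j
    then !f z else f z
  have hval : ∀ (t : Fin r) (p : Fin (q ^ r)), h t (S p) =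
      if t.val < level p then !f (S p) else f (S p) := by
    intro t p
    simp only [h]
    congr 1
    refine propext ⟨?_, fun hlt => ⟨⟨level p, Nat.lt_succ_of_le (hlevel_le p)⟩, hlt, rfl⟩⟩
    rintro ⟨j, hj, hS⟩
    have := x.injective hS
    rw [← this] at hj
    exact hj
  have hweak : B.WeakAnswers β f S h := by
    intro t
    -- Examples of level at least `t` have been misclassified in every earlier call, so they share
    -- one weight. Only a fraction `1/q ≤ β` of them is misclassified now, whatever the weights of
    -- the other examples.
    set w := B.weight t fun _ => false with hw
    have hw0 : 0 ≤ w := B.weight_nonneg _ _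
    have hwt : ∀ p : Fin (q ^ r), t.val ≤ level p → B.exampleWeight f h t (S p) = w := by
      intro p hp
      rw [WeightBooster.exampleWeight, hw]
      congr 1
      funext s
      have hs : (Fin.castLE t.isLt.le s).val < level p := lt_of_lt_of_le s.isLt hp
      rw [hval, if_pos hs]
      simp
    have hcard : ∀ i ≤ r, (univ.filter fun p : Fin (q ^ r) => i ≤ level p).card = q ^ (r - i) := by
      intro i hi
      have h1 : (univ.filter fun p : Fin (q ^ r) => i ≤ level p) =
          univ.filter fun p : Fin (q ^ r) => p.val < q ^ (r - i) :=
        filter_congr fun p _ => hlevel p p.isLt i hi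
      rw [h1, Fin.card_filter_val_lt]
      exact min_eq_right (Nat.pow_le_pow_right hqpos (by omega))
    have hlhs : ∑ p, (if h t (S p) ≠ f (S p) then B.exampleWeight f h t (S p) else 0) =
        q ^ (r - (t.val + 1)) * w := by
      have h1 : ∀ p : Fin (q ^ r),
          (if h t (S p) ≠ f (S p) then B.exampleWeight f h t (S p) else 0) =
          if t.val + 1 ≤ level p then w else 0 := by
        intro p
        rw [hval]
        by_cases hp : t.val < level p
        · simp [hp, Nat.succ_le_of_lt hp, hwt p hp.le]
        · simp [hp]
      simp only [h1]
      rw [← sum_filter, sum_const, hcard _ t.isLt, nsmul_eq_mul]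
      push_cast; rfl
    have hrhs : q ^ (r - t.val) * w ≤ ∑ p, B.exampleWeight f h t (S p) := by
      calc (q ^ (r - t.val) * w : ℝ) =
          ∑ p ∈ univ.filter (fun p : Fin (q ^ r) => t.val ≤ level p), w := by
            rw [sum_const, hcard _ t.isLt.le, nsmul_eq_mul]; push_cast; rfl
        _ = ∑ p ∈ univ.filter (fun p : Fin (q ^ r) => t.val ≤ level p),
            B.exampleWeight f h t (S p) :=
            sum_congr rfl fun p hp => (hwt p (mem_filter.1 hp).2).symm
        _ ≤ _ := sum_le_sum_of_subset_of_nonneg (filter_subset _ _) fun p _ _ =>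
            B.weight_nonneg _ _
    rw [hlhs]
    refine le_trans ?_ (mul_le_mul_of_nonneg_left hrhs hβ.le)
    have h2 : (q : ℝ) ^ (r - t.val) = q * q ^ (r - (t.val + 1)) := by
      rw [← pow_succ']; congr 1; have := t.isLt; omega
    rw [h2]
    have h3 : 0 ≤ (q : ℝ) ^ (r - (t.val + 1)) * w := by positivity
    nlinarith
  have hfin := hB f hf (q ^ r) S h hweak
  -- Example 0 has level `r`, so all `r` hypotheses err on it; the combination of unanimous votes
  -- follows them.
  have hne : (univ.filter fun p : Fin (q ^ r) =>
      B.combine (fun t => h t (S p)) ≠ f (S p)).Nonempty := by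
    refine ⟨⟨0, by positivity⟩, mem_filter.2 ⟨mem_univ _, ?_⟩⟩
    have hl : level 0 = r := le_antisymm (hlevel_le 0)
      ((hlevel 0 (by positivity) r le_rfl).2 (by positivity))
    have h1 : (fun t : Fin r => h t (S ⟨0, by positivity⟩)) =
        fun _ => !f (S ⟨0, by positivity⟩) := by
      funext t
      rw [hval, if_pos (by change t.val < level 0; rw [hl]; exact t.isLt)]
    rw [h1, hB.combine_eq hβ.le hε hd hd0]
    simp
  have h1 : (1 : ℝ) ≤ (univ.filter fun p : Fin (q ^ r) =>
      B.combine (fun t => h t (S p)) ≠ f (S p)).card := by exact_mod_cast card_pos.2 hne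
  refine h1.trans (hfin.trans (le_of_eq ?_))
  push_cast; rfl

theorem WeightBooster.Achieves.log_le (hB : B.Achieves H β ε) (hβ : 0 < β) (hβ' : β < 1 / 2)
    (hε0 : 0 < ε) (hε : ε < 1) {d : ℕ} (hd : HasVCDim H d) (hd0 : 0 < d) (x : Fin (r + 1) ↪ X) :
    Real.log (1 / ε) ≤ 2 * r * Real.log (1 / β) := by
  have h := hB.one_le_mul_pow hβ hε hd hd0 x
  have h2 : 2 ≤ 1 / β := by rw [le_div_iff₀ hβ]; linarith
  -- Rounding up is absorbed by a square because `1/β ≥ 2`; this is the factor 2 in the bound.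
  have h1 : (⌈1 / β⌉₊ : ℝ) ≤ (1 / β) ^ 2 := by
    have := (Nat.ceil_lt_add_one (show 0 ≤ 1 / β by positivity)).le
    nlinarith
  have h3 : 1 / ε ≤ ((1 / β) ^ 2) ^ r := by
    rw [div_le_iff₀ hε0, mul_comm]
    exact h.trans (by gcongr)
  have h4 := Real.log_le_log (by positivity) h3
  rw [Real.log_pow, Real.log_pow] at h4
  push_cast at h4
  linarith

end LowerBound

end DistLearn

namespace DistLearn

/-! ## The three protocols -/

theorem log_sixteen_mul_le {d : ℕ} (hd : 0 < d) {y : ℝ} (hy : 2 ≤ y) (hdy : d ≤ y) :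
    Real.log (16 * d) ≤ 5 * Real.log y := by
  have hd' : (0 : ℝ) < d := by exact_mod_cast hd
  rw [show (16 : ℝ) = 2 ^ 4 by norm_num, Real.log_mul (by norm_num) hd'.ne', Real.log_pow]
  have h1 := Real.log_le_log (by norm_num) hy
  have h2 := Real.log_le_log hd' hdy
  push_cast
  linarith

variable {X : Type u} [MeasurableSpace X] {H : Set (X → Bool)} {d k : ℕ} {δ : ℝ}

/-- Simulation of a weight-based booster. -/
theorem learnableWithin_of_achieves (hH : IsMeasurableClass H) (hd : HasVCDim H d) (hk : 0 < k)
    (hδ : 0 < δ) (hδ1 : δ < 1) {C : ℝ} (hC : 36864 + (4 + 8 * Real.log (16 / δ)) ≤ C)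
    {β ε : ℝ} {r : ℕ} {B : WeightBooster r} (hβ : 0 < β) (hβ' : β < 1 / 2) (hε : 0 < ε)
    (hB : B.Achieves H β ε) :
    LearnableWithin H k ε δ (C * r) (C * (d / β * Real.log (1 / β)))
      (C * (k * Real.log (d / β))) := by
  have hδlog : 0 ≤ Real.log (16 / δ) := Real.log_nonneg (by rw [le_div_iff₀ hδ]; linarith)
  have hC0 : 36864 ≤ C := by linarith
  have hk0 : (0 : ℝ) ≤ k := Nat.cast_nonneg _
  have hl2 := Real.log_two_gt_d9
  have hβ2 : 2 ≤ 1 / β := by rw [le_div_iff₀ hβ]; linarith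
  have hℓ : Real.log 2 ≤ Real.log (1 / β) := Real.log_le_log (by norm_num) hβ2
  rcases Nat.eq_zero_or_pos d with rfl | hd0
  · exact learnableWithin_of_vcDim_zero hd (by positivity) (by simp) (by simp)
  have hd1 : (1 : ℝ) ≤ d := by exact_mod_cast hd0
  have hdβ : 1 / β ≤ d / β := by gcongr
  have hLog : Real.log 2 ≤ Real.log (d / β) := Real.log_le_log (by norm_num) (hβ2.trans hdβ)
  have hE0 : 0 ≤ d / β * Real.log (1 / β) := mul_nonneg (by positivity) (by linarith)
  have hB0 : 0 ≤ k * Real.log (d / β) := mul_nonneg hk0 (by linarith)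
  rcases le_or_gt 1 ε with hε1 | hε1
  · refine learnableWithin_of_const (fun _ => false) (fun D hD f _ => ?_) (by positivity)
      (by positivity) (by positivity)
    exact (mixture_le_one hk D hD _).trans (by simpa using hε1)
  have hr : (1 : ℝ) ≤ r := by exact_mod_cast hB.calls_pos hβ.le hε1 hd hd0
  -- With more than `r` points, the lower bound on `r` makes the boosting protocol fast enough, and
  -- `B` itself need not be simulated.
  by_cases hx : Nonempty (Fin (r + 1) ↪ X)
  · obtain ⟨x⟩ := hx
    have hlog := hB.log_le hβ hβ' hε hε1 hd hd0 x
    rcases le_or_gt β (1 / 16) with hβ16 | hβ16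
    · refine (learnableWithin_of_beta hH hd hd0 hk hβ hβ16 hε hε1 hδ hδ1).mono ?_ ?_ ?_
      · have h1 : Real.log (1 / ε) / Real.log (1 / β) ≤ 2 * r := by
          rwa [div_le_iff₀ (by linarith)]
        nlinarith
      · gcongr; linarith
      · gcongr; linarith
    · refine (learnableWithin_const hH hd hd0 hk hε hε1 hδ hδ1).mono ?_ ?_ ?_
      · have h2 : Real.log (1 / β) ≤ Real.log 16 :=
          Real.log_le_log (by positivity) (by rw [div_le_iff₀ hβ]; linarith)
        have h1 : Real.log (1 / ε) / Real.log 16 ≤ 2 * r := by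
          rw [div_le_iff₀ (by linarith)]
          exact hlog.trans (by gcongr)
        nlinarith
      · have h1 : (d : ℝ) ≤ d / β := by
          rw [le_div_iff₀ hβ]; nlinarith
        -- As `log 2 ≥ 1/2`, the `18432 d` examples fit if `C ≥ 2 * 18432 = 36864`.
        have h2 : (d : ℝ) * (1 / 2) ≤ d / β * Real.log (1 / β) := by gcongr; linarith
        nlinarith
      · have h1 := log_sixteen_mul_le hd0 (hβ2.trans hdβ)
          (show (d : ℝ) ≤ d / β by rw [le_div_iff₀ hβ]; nlinarith)
        have h2 : k * Real.log (16 * d) ≤ k * (5 * Real.log (d / β)) := by gcongr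
        nlinarith
  -- Now the domain has at most `r` points, and announcing them one per round fits into `r` rounds.
  · have hfin : Finite X := by
      by_contra hinf
      rw [not_finite_iff_infinite] at hinf
      exact hx ⟨(Fin.valEmbedding).trans (Infinite.natEmbedding X)⟩
    have := Fintype.ofFinite X
    have hcard : Fintype.card X ≤ r := by
      by_contra hlt
      exact hx (Function.Embedding.nonempty_of_card_le (by simp; omega))
    refine (learnableWithin_of_finite hH.measurable_mem hk hε hδ).mono ?_ (by positivity) ?_
    · have h1 : (Fintype.card X : ℝ) ≤ r := by exact_mod_cast hcard
      nlinarith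
    · have h1 : (1 : ℝ) ≤ C * Real.log (d / β) := by nlinarith
      nlinarith

/-- Logarithmically many rounds with `O(d)` examples each. -/
theorem learnableWithin_log_rounds (hH : IsMeasurableClass H) (hd : HasVCDim H d) (hk : 0 < k)
    (hδ : 0 < δ) (hδ1 : δ < 1) {C : ℝ} (hC : 36864 + 2 * (4 + 8 * Real.log (16 / δ)) ≤ C)
    {ε : ℝ} (hε : 0 < ε) (hε2 : ε ≤ 1 / 2) :
    LearnableWithin H k ε δ (C * Real.log (1 / ε)) (C * d) (C * (k * Real.log (d + 1))) := by
  have hδlog : 0 ≤ Real.log (16 / δ) := Real.log_nonneg (by rw [le_div_iff₀ hδ]; linarith)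
  have hC0 : 36864 ≤ C := by linarith
  have hk0 : (0 : ℝ) ≤ k := Nat.cast_nonneg _
  have hl2 := Real.log_two_gt_d9
  have hlε : Real.log 2 ≤ Real.log (1 / ε) :=
    Real.log_le_log (by norm_num) (by rw [le_div_iff₀ hε]; linarith)
  rcases Nat.eq_zero_or_pos d with rfl | hd0
  · exact learnableWithin_of_vcDim_zero hd (mul_nonneg (by linarith) (by linarith))
      (by simp) (by simp)
  have hd1 : (1 : ℝ) ≤ d := by exact_mod_cast hd0
  refine (learnableWithin_const hH hd hd0 hk hε (by linarith) hδ hδ1).mono ?_ ?_ ?_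
  · have h16 : 1 ≤ Real.log 16 := by
      rw [show (16 : ℝ) = 2 ^ 4 by norm_num, Real.log_pow]; push_cast; linarith
    have h1 : Real.log (1 / ε) / Real.log 16 ≤ Real.log (1 / ε) := div_le_self (by linarith) h16
    nlinarith
  · gcongr; linarith
  · have h1 := log_sixteen_mul_le hd0 (show (2 : ℝ) ≤ d + 1 by linarith)
      (show (d : ℝ) ≤ d + 1 by linarith)
    have h2 : k * Real.log (16 * d) ≤ k * (5 * Real.log (d + 1)) := by gcongr
    have h3 : 0 ≤ k * Real.log ((d : ℝ) + 1) := mul_nonneg hk0 (Real.log_nonneg (by linarith))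
    nlinarith

/-- A trade-off between the number of rounds and the number of examples. -/
theorem learnableWithin_tradeoff (hH : IsMeasurableClass H) (hd : HasVCDim H d) (hk : 0 < k)
    (hδ : 0 < δ) (hδ1 : δ < 1) {C : ℝ} (hC : 36864 + (4 + 8 * Real.log (16 / δ)) ≤ C)
    {c ε : ℝ} (hc : 1 ≤ c) (hε : 0 < ε) (hε2 : ε ≤ 1 / 2) :
    LearnableWithin H k ε δ (C * c) (C * (d / ε ^ (1 / c) * Real.log (1 / ε)))
      (C * (k * Real.log (d / ε))) := by
  have hδlog : 0 ≤ Real.log (16 / δ) := Real.log_nonneg (by rw [le_div_iff₀ hδ]; linarith)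
  have hC0 : 36864 ≤ C := by linarith
  have hk0 : (0 : ℝ) ≤ k := Nat.cast_nonneg _
  have hl2 := Real.log_two_gt_d9
  have hε2' : 2 ≤ 1 / ε := by rw [le_div_iff₀ hε]; linarith
  have hlε : Real.log 2 ≤ Real.log (1 / ε) := Real.log_le_log (by norm_num) hε2'
  rcases Nat.eq_zero_or_pos d with rfl | hd0
  · exact learnableWithin_of_vcDim_zero hd (by positivity) (by simp) (by simp)
  have hd1 : (1 : ℝ) ≤ d := by exact_mod_cast hd0
  -- With this `β`, `log (1/ε) = c log (1/β)`, so the number of calls is of order `c`.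
  set β := ε ^ (1 / c) with hβ
  have hβ0 : 0 < β := Real.rpow_pos_of_pos hε _
  have hc1 : 1 / c ≤ 1 := by rw [div_le_one (by linarith)]; exact hc
  have hεβ : ε ≤ β := by
    have := Real.rpow_le_rpow_of_exponent_ge hε (by linarith) hc1
    rwa [Real.rpow_one] at this
  have hβ1 : β ≤ 1 := Real.rpow_le_one hε.le (by linarith) (by positivity)
  have hlβ : Real.log (1 / ε) = c * Real.log (1 / β) := by
    rw [one_div, one_div, Real.log_inv, Real.log_inv, hβ, Real.log_rpow hε]
    field_simp
  have hlβ0 : 0 ≤ Real.log (1 / β) := Real.log_nonneg (by rwa [le_div_iff₀ hβ0, one_mul])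
  have hdε : 1 / ε ≤ d / ε := by gcongr
  have hLog : Real.log 2 ≤ Real.log (d / ε) := Real.log_le_log (by norm_num) (hε2'.trans hdε)
  have hE0 : 0 ≤ d / β * Real.log (1 / ε) := mul_nonneg (by positivity) (by linarith)
  have hB0 : 0 ≤ k * Real.log (d / ε) := mul_nonneg hk0 (by linarith)
  rcases le_or_gt β (1 / 16) with hβ16 | hβ16
  · refine (learnableWithin_of_beta hH hd hd0 hk hβ0 hβ16 hε (by linarith) hδ hδ1).mono ?_ ?_ ?_
    · have hpos : 0 < Real.log (1 / β) :=
        Real.log_pos (by rw [lt_div_iff₀ hβ0]; linarith)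
      rw [hlβ, mul_div_assoc, div_self hpos.ne']
      nlinarith
    · have h1 : d / β * Real.log (1 / β) ≤ d / β * Real.log (1 / ε) := by
        gcongr
      nlinarith
    · have h1 : k * Real.log (d / β) ≤ k * Real.log (d / ε) := by gcongr
      nlinarith
  · refine (learnableWithin_const hH hd hd0 hk hε (by linarith) hδ hδ1).mono ?_ ?_ ?_
    · have h2 : Real.log (1 / β) ≤ Real.log 16 :=
        Real.log_le_log (by positivity) (by rw [div_le_iff₀ hβ0]; linarith)
      have h16 : 0 < Real.log 16 := Real.log_pos (by norm_num)
      have h1 : Real.log (1 / ε) / Real.log 16 ≤ c := by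
        rw [div_le_iff₀ h16, hlβ]
        gcongr
      nlinarith
    · have h1 : (d : ℝ) ≤ d / β := by
        rw [le_div_iff₀ hβ0]; nlinarith
      have h2 : (d : ℝ) * (1 / 2) ≤ d / β * Real.log (1 / ε) := by gcongr; linarith
      nlinarith
    · have h1 := log_sixteen_mul_le hd0 (hε2'.trans hdε)
        (show (d : ℝ) ≤ d / ε by rw [le_div_iff₀ hε]; nlinarith)
      have h2 : k * Real.log (16 * d) ≤ k * (5 * Real.log (d / ε)) := by gcongr
      nlinarith

end DistLearn

theorem theorem10 (δ : ℝ) (hδ₀ : 0 < δ) (hδ₁ : δ < 1) :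
    ∃ C : ℝ, 0 < C ∧
      ∀ (X : Type u) [MeasurableSpace X] (H : Set (X → Bool)) (d k : ℕ),
        DistLearn.IsMeasurableClass H → DistLearn.HasVCDim H d → 0 < k →
        (∀ (β ε : ℝ) (r : ℕ) (B : DistLearn.WeightBooster r),
          0 < β → β < 1 / 2 → 0 < ε → B.Achieves H β ε →
          DistLearn.LearnableWithin H k ε δ (C * r)
            (C * (d / β * Real.log (1 / β))) (C * (k * Real.log (d / β)))) ∧
        (∀ ε : ℝ, 0 < ε → ε ≤ 1 / 2 →
          DistLearn.LearnableWithin H k ε δ (C * Real.log (1 / ε))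
            (C * d) (C * (k * Real.log (d + 1)))) ∧
        (∀ c ε : ℝ, 1 ≤ c → 0 < ε → ε ≤ 1 / 2 →
          DistLearn.LearnableWithin H k ε δ (C * c)
            (C * (d / ε ^ (1 / c) * Real.log (1 / ε)))
            (C * (k * Real.log (d / ε)))) := by
  have hδlog : 0 ≤ Real.log (16 / δ) := Real.log_nonneg (by rw [le_div_iff₀ hδ₀]; linarith)
  -- The factor 2 lets `log (1/ε) ≥ log 2 ≥ 1/2` absorb the additive term depending on `δ` in part
  -- 2.
  refine ⟨36864 + 2 * (4 + 8 * Real.log (16 / δ)), by positivity, ?_⟩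
  intro X _ H d k hH hd hk
  exact ⟨fun β ε r B hβ hβ' hε hB =>
      DistLearn.learnableWithin_of_achieves hH hd hk hδ₀ hδ₁ (by linarith) hβ hβ' hε hB,
    fun ε hε hε2 => DistLearn.learnableWithin_log_rounds hH hd hk hδ₀ hδ₁ le_rfl hε hε2,
    fun c ε hc hε hε2 =>
      DistLearn.learnableWithin_tradeoff hH hd hk hδ₀ hδ₁ (by linarith) hc hε hε2⟩
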